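/- **Setting.** All transfer functions are matrices of rational functions of $z$ with complex coefficients. Write $M^*(z)=\overline{M(\bar z^{-1})}^{\top}$, the conjugate transpose on the unit circle. $M$ is *stable* if all its poles lie in $|z|<1$ (so it is analytic in $|z|\ge 1$, including $z=\infty$, i.e. its entries are in the Hardy space $\mathbf H^2$). $M$ is *minimum-phase* (outer) if it is stable and has all its zeros in $|z|\le 1$, i.e. $M(\alpha)v\neq 0$ whenever $v\ne 0$ and $|\alpha|>1$ or $\alpha=\infty$. $Q$ is *inner* if it is stable and $QQ^*=I$. For $S$ without poles on the unit circle, $[S]_+$ is the entrywise orthogonal projection of $S$ from $L^2$ of the circle onto $\mathbf H^2$. Let $y=(y_1,y_2)$, with $y_1(t)$ of dimension $m$ and $y_2(t)$ of dimension $p$, be a stationary second-order process with rational spectral density $\Phi=(\Phi_{ij})_{i,j=1,2}$. Let $\Phi=WW^*$, $W=\begin{bmatrix}W_1\\W_2\end{bmatrix}$, where $W$ is an $(m+p)\times m$ minimum-phase spectral factor with $W_1$ square ($m\times m$) and $\det W_1\not\equiv0$, and let $y(t)=W(z)e(t)$, where $e$ is an $m$-dimensional zero-mean white noise normalized by $\mathbb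 E\,e(t)e(s)^*=\delta_{ts}I$. Let $W_2=G_2Q_2$ be an outer–inner factorization: $G_2$ is $p\times r$ minimum-phase and $Q_2$ is $r\times m$ inner. A filter $T(z)u(t)$ on a process $u$ with spectral density $\Phi_u$ is understood in the spectral domain (mean-square limit of $P_n(z)u(t)$, where the rows of the Laurent polynomial matrices $P_n$ tend to those of $T$ in $L^2(\Phi_u)$), so $T$ need not be stable. A *one-step-ahead Wiener filter* from $y_2$ to $y_1$ is a rational matrix $F$ such that $F(z)y_2(t-1)$ is defined and equals, for each $t$, the orthogonal projection $\mathbb E\{y_1(t)\mid \mathbf H^-_{t-1}(y_2)\}$ of $y_1(t)$ onto the closed linear span of the components of $y_2(s)$, $s\le t-1$. **Theorem.** (1) $G_2$ is a full-rank spectral factor of $\Phi_{22}$: $\Phi_{22}=G_2G_2^*$ and $\operatorname{rank}G_2=\operatorname{rank}W_2=r$; it has a rational left inverse. (2) The process satisfies $y_2(t)=H(z)y_1(t)$ with $H=\Phi_{21}\Phi_{11}^{-1}$. (3) The rational stable matrix $S_+=[zW_1Q_2^*]_+$ exists and is unique, $K_+=W_1-z^{-1}[zW_1Q_2^*]_+Q_2$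 is stable, and for every rational left inverse $G_2^{-L}$ of $G_2$, with $F_+=[zW_1Q_2^*]_+G_2^{-L}$, $$y_1(t)=F_+(z)\,y_2(t-1)+K_+(z)\,e(t),\qquad F_+(z)\,y_2(t-1)=\mathbb E\{y_1(t)\mid \mathbf H^-_{t-1}(y_2)\}.$$ Thus this is a forward loop of the feedback model $y_1(t)=F(z)y_2(t)+K(z)e(t)$, $y_2(t)=H(z)y_1(t)$, with $F=z^{-1}F_+$ and $K=K_+$, and $F_+$ is a one-step-ahead Wiener filter from $y_2$ to $y_1$. (4) A rational $m\times p$ matrix $F$ is a one-step-ahead Wiener filter from $y_2$ to $y_1$ if and only if $FG_2=[zW_1Q_2^*]_+$. The filters of the form $[zW_1Q_2^*]_+G_2^{-L}$, with $G_2^{-L}$ a rational left inverse of $G_2$, are exactly those Wiener filters $F$ that can be written $F=[zW_1Q_2^*]_+X$ with $X$ rational. -/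

import Mathlib

open MeasureTheory

noncomputable section

namespace LowRankWiener

/-! Transfer functions are matrices over `RatFunc ℂ`. The indeterminate `RatFunc.X` stands for the
unit delay `z⁻¹`, so the exterior `|z| > 1` of the unit circle, with the point `z = ∞`, is the open
disc `|w| < 1` in the variable `w = z⁻¹` of `RatFunc ℂ`, and `z = ∞` is `w = 0`. -/

/-- The variable `z` (unit advance). -/
def zVar : RatFunc ℂ := (RatFunc.X)⁻¹

/-- Value of a rational function at the point `w = z⁻¹`. -/
def evalAt (w : ℂ) (f : RatFunc ℂ) : ℂ := RatFunc.eval (RingHom.id ℂ) w f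

/-- `f` has a pole at the point `w = z⁻¹` (`num` and `denom` are coprime). -/
def HasPoleAt (f : RatFunc ℂ) (w : ℂ) : Prop := f.denom.eval w = 0

/-- The para-conjugate of a scalar rational function: `z ↦ conj (f (1 / conj z))`, i.e. the
coefficients are conjugated and the variable is inverted. -/
def paraConj (f : RatFunc ℂ) : RatFunc ℂ :=
  Polynomial.aeval zVar (f.num.map (starRingEnd ℂ)) /
    Polynomial.aeval zVar (f.denom.map (starRingEnd ℂ))

/-- The para-conjugate transpose `M*` of a rational matrix (on the unit circle this is the
conjugate transpose). -/
def paraStar {ι κ : Type*} (M : Matrix ι κ (RatFunc ℂ)) : Matrix κ ι (RatFunc ℂ) :=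
  (M.map paraConj).transpose

/-- No poles on the unit circle (for rational matrices: square integrable on the circle). -/
def NoCirclePoles {ι κ : Type*} (M : Matrix ι κ (RatFunc ℂ)) : Prop :=
  ∀ i j, ∀ w : ℂ, ‖w‖ = 1 → ¬ HasPoleAt (M i j) w

/-- Causal and stable: all poles satisfy `|z| < 1`; equivalently, analytic in `|z| ≥ 1`, `z = ∞`
included. These are the rational matrices with entries in the Hardy space `H²`. -/
def IsStable {ι κ : Type*} (M : Matrix ι κ (RatFunc ℂ)) : Prop :=
  ∀ i j, ∀ w : ℂ, ‖w‖ ≤ 1 → ¬ HasPoleAt (M i j) w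

/-- Minimum-phase (outer): all poles in `|z| < 1`, and all zeros in `|z| ≤ 1`, where a zero is a
point `α` (possibly `∞`) at which `M(α) v = 0` for some vector `v ≠ 0`. -/
def IsMinimumPhase {ι κ : Type*} [Fintype κ] (M : Matrix ι κ (RatFunc ℂ)) : Prop :=
  IsStable M ∧ ∀ w : ℂ, ‖w‖ < 1 → ∀ v : κ → ℂ, v ≠ 0 → (M.map (evalAt w)).mulVec v ≠ 0

/-- Inner: stable with `Q Q* = I`. -/
def IsInner {ι κ : Type*} [DecidableEq ι] [Fintype κ] (Q : Matrix ι κ (RatFunc ℂ)) : Prop :=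
  IsStable Q ∧ Q * paraStar Q = 1

/-- The value at the point `θ` of the unit circle. -/
def onCircle (f : RatFunc ℂ) (θ : UnitAddCircle) : ℂ := evalAt (AddCircle.toCircle θ : ℂ) f

/-- The coefficient of `w ^ k = z ^ (-k)` in the Laurent (Fourier) expansion of `f` on the unit
circle. -/
def laurentCoeff (f : RatFunc ℂ) (k : ℤ) : ℂ := fourierCoeff (onCircle f) k

/-- `Splus = [S]₊`: the (entrywise) orthogonal projection of `S ∈ L²` onto `H²`. That is, `Splus`
is in `H²` and `S - Splus` is orthogonal to `H²`, the closed span of the `z ^ (-k)`, `k ≥ 0`. -/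
def IsHardyProjection {ι κ : Type*} (S Splus : Matrix ι κ (RatFunc ℂ)) : Prop :=
  NoCirclePoles S ∧ IsStable Splus ∧ ∀ i j, ∀ k : ℤ, 0 ≤ k → laurentCoeff ((S - Splus) i j) k = 0

section RandomVectors

variable {Ω : Type*} [MeasurableSpace Ω]

/-- Vector processes in discrete time whose components are second-order complex random variables. -/
abbrev RandomSeq (P : Measure Ω) (ι : Type*) : Type _ := ℤ → ι → Lp ℂ 2 P

variable {P : Measure Ω}

/-- Normalized white noise: zero mean, `E[e(t) e(s)*] = δ_{ts} I`. -/
def IsNormalizedWhiteNoise {κ : Type*} (e : RandomSeq P κ) : Prop :=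
  (∀ t j, ∫ ω, e t j ω ∂P = 0) ∧ Orthonormal ℂ (fun q : ℤ × κ => e q.1 q.2)

/-- `Φ` is the (rational) spectral density of the stationary process `y`:
`E[y_i(t+s) conj (y_j(t))]` is the coefficient of `z ^ (-s)` in `Φ_ij`. -/
def HasSpectralDensity {ι : Type*} (y : RandomSeq P ι) (Φ : Matrix ι ι (RatFunc ℂ)) : Prop :=
  NoCirclePoles Φ ∧
    ∀ (t s : ℤ) (i j : ι), inner ℂ (y t j) (y (t + s) i) = laurentCoeff (Φ i j) s

/-- A finitely supported `c : ℤ × κ →₀ ℂ` is a row vector of Laurent polynomials, with `j`-th entry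
`∑ k, c (k, j) z ^ (-k)`. This is its value on the circle. -/
def laurentRow {κ : Type*} [DecidableEq κ] (c : ℤ × κ →₀ ℂ) (θ : UnitAddCircle) (j : κ) : ℂ :=
  c.sum fun q a => if q.2 = j then a * fourier q.1 θ else 0

/-- The action of a row of Laurent polynomials on a process: `∑ c (k, j) u_j(t - k)`. -/
def laurentApply {κ : Type*} (c : ℤ × κ →₀ ℂ) (u : RandomSeq P κ) (t : ℤ) : Lp ℂ 2 P :=
  c.sum fun q a => a • u (t - q.1) q.2

/-- The squared norm `∫ (f - c) Φ (f - c)*` in `L²(Φ)` of the difference of a row `f` of rational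
functions and a row `c` of Laurent polynomials. -/
def spectralDist {κ : Type*} [Fintype κ] [DecidableEq κ] (Φ : Matrix κ κ (RatFunc ℂ))
    (f : κ → RatFunc ℂ) (c : ℤ × κ →₀ ℂ) : ENNReal :=
  ∫⁻ θ : UnitAddCircle, ENNReal.ofReal
    (∑ j, ∑ k, (onCircle (f j) θ - laurentRow c θ j) * onCircle (Φ j k) θ *
      (starRingEnd ℂ) (onCircle (f k) θ - laurentRow c θ k)).re ∂AddCircle.haarAddCircle

/-- `x(t) = T(z) u(t)`, where `u` is a stationary process with spectral density `Φ`. This is the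
spectral-domain definition of a filter, valid for every `T` whose rows are in `L²(Φ)` (poles on or
outside the circle are allowed): `x_i(t)` is the mean-square limit of `c(z) u(t)` as the row `c` of
Laurent polynomials tends to the `i`-th row of `T` in `L²(Φ)`. -/
def IsFilterOutput {ι κ : Type*} [Fintype κ] [DecidableEq κ] (Φ : Matrix κ κ (RatFunc ℂ))
    (T : Matrix ι κ (RatFunc ℂ)) (u : RandomSeq P κ) (x : RandomSeq P ι) : Prop :=
  ∀ (t : ℤ) (i : ι) (ε : ℝ), 0 < ε → ∃ c : ℤ × κ →₀ ℂ,
    spectralDist Φ (T i) c < ENNReal.ofReal ε ∧ ‖x t i - laurentApply c u t‖ < ε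

/-- The past of `u` up to and including time `t`: the closed linear span of the `u_j(s)`,
`s ≤ t`, in the Hilbert space of second-order random variables. -/
def past {κ : Type*} (u : RandomSeq P κ) (t : ℤ) : Submodule ℂ (Lp ℂ 2 P) :=
  (Submodule.span ℂ {v | ∃ s : ℤ, s ≤ t ∧ ∃ j, v = u s j}).topologicalClosure

/-- The one-step-ahead linear least-squares predictor of `y₁(t)` from the strict past of `y₂`:
the orthogonal projection of `y₁(t)` onto the closed span of the `y₂(s)`, `s ≤ t - 1`. -/
def oneStepPredictor {ι κ : Type*} (y₁ : RandomSeq P ι) (y₂ : RandomSeq P κ) : RandomSeq P ι :=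
  fun t i =>
    haveI : CompleteSpace (past y₂ (t - 1)) :=
      (Submodule.isClosed_topologicalClosure _).completeSpace_coe
    (past y₂ (t - 1)).starProjection (y₁ t i)

/-- `F` is a one-step-ahead Wiener filter from `y₂` (with spectral density `Φ₂₂`) to `y₁`:
`F(z) y₂(t-1)` is well defined and is the one-step-ahead predictor of `y₁(t)`. -/
def IsWienerFilter {ι κ : Type*} [Fintype κ] [DecidableEq κ] (Φ₂₂ : Matrix κ κ (RatFunc ℂ))
    (y₁ : RandomSeq P ι) (y₂ : RandomSeq P κ) (F : Matrix ι κ (RatFunc ℂ)) : Prop :=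
  ∃ x : RandomSeq P ι, IsFilterOutput Φ₂₂ F y₂ x ∧
    ∀ t i, x (t - 1) i = oneStepPredictor y₁ y₂ t i

end RandomVectors

end LowRankWiener

end

open LowRankWiener

open MeasureTheory

noncomputable section

namespace LowRankWiener

/-! Everything is carried to the white noise. The isometry `noiseIsometry` sends `w ^ k` to `e (-k)
j`, so a row `h` of functions on the circle becomes the random variable `synth he t h`, and
covariances become inner products in `L²` of the circle. In this picture `y₁` is `W₁`, `y₂` is `W₂ =
G₂ Q₂`, and multiplication by `w = z⁻¹` is the unit delay.

For `u = G e` and `Φ = G G*`, the distance in `L²(Φ)` from a row `f` to a Laurent row `c` is the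
`L²` distance from `f G` to `c G`. Hence `T u` is the process `S e` exactly when `T G = S`, for `S`
without circle poles (`isFilterOutput_of_mul_eq`, `IsFilterOutput.eq_synth`,
`IsFilterOutput.mul_eq`). Poles of `T` do no harm, because only the product `T G` is seen.

The predictor is `S₊ Q₂ e(t-1)` with `S₊ = [z W₁ Q₂*]₊` (`oneStepPredictor_eq_synth`), for two
reasons. The error is orthogonal to the strict past: `(W₁ - z⁻¹ S₊ Q₂)(G₂ Q₂)* = z⁻¹ (z W₁ Q₂* - S₊)
G₂*`, where `z W₁ Q₂* - S₊` is orthogonal to `H²` and `G₂` is stable. And `S₊ Q₂ e(t-1)` lies in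
that past because `G₂` is outer: there are a stable `L` and a polynomial `d` without zeros in `|w| <
1` with `L G₂ = d`, and a stable `q` with `q d` close to `1` in `L²`, so `q S₊ L` applied to `y₂`
comes close to `S₊ Q₂ e`. The approximation, instead of an inverse of `d`, is what allows zeros of
`G₂` on the circle.

So `F` is a Wiener filter if and only if `F G₂ Q₂ = S₊ Q₂`, and `Q₂ Q₂* = I` cancels `Q₂`. The
remaining claims are linear algebra over the rational functions. -/

/-! ### Rational functions regular on a set, and their values. -/

/-- The rational functions without poles in `s`. -/
def regularOn (s : Set ℂ) : Subring (RatFunc ℂ) where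
  carrier := {f | ∀ w ∈ s, ¬ HasPoleAt f w}
  mul_mem' {f g} hf hg w hw h := by
    have := Polynomial.eval_eq_zero_of_dvd_of_eval_eq_zero (RatFunc.denom_mul_dvd f g) h
    rw [Polynomial.eval_mul, mul_eq_zero] at this
    exact this.elim (hf w hw) (hg w hw)
  add_mem' {f g} hf hg w hw h := by
    have := Polynomial.eval_eq_zero_of_dvd_of_eval_eq_zero (RatFunc.denom_add_dvd f g) h
    rw [Polynomial.eval_mul, mul_eq_zero] at this
    exact this.elim (hf w hw) (hg w hw)
  one_mem' w _ h := by simp [HasPoleAt] at h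
  zero_mem' w _ h := by simp [HasPoleAt] at h
  neg_mem' {f} hf w hw h := by
    refine hf w hw ?_
    have hd : f.denom ∣ (-f).denom := by
      rw [RatFunc.denom_dvd (RatFunc.denom_ne_zero _)]
      refine ⟨-(-f).num, ?_⟩
      rw [map_neg, neg_div, RatFunc.num_div_denom, neg_neg]
    have hd' : (-f).denom ∣ f.denom := by
      rw [RatFunc.denom_dvd (RatFunc.denom_ne_zero _)]
      refine ⟨-f.num, ?_⟩
      rw [map_neg, neg_div, RatFunc.num_div_denom]
    exact Polynomial.eval_eq_zero_of_dvd_of_eval_eq_zero hd' h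

theorem mem_regularOn {s : Set ℂ} {f : RatFunc ℂ} :
    f ∈ regularOn s ↔ ∀ w ∈ s, ¬ HasPoleAt f w := Iff.rfl

theorem regularOn_mono {s t : Set ℂ} (h : s ⊆ t) : regularOn t ≤ regularOn s :=
  fun _ hf w hw => hf w (h hw)

theorem div_mem_regularOn {s : Set ℂ} (a b : Polynomial ℂ) (hb : ∀ w ∈ s, b.eval w ≠ 0) :
    algebraMap _ (RatFunc ℂ) a / algebraMap _ (RatFunc ℂ) b ∈ regularOn s := fun w hw h =>
  hb w hw (Polynomial.eval_eq_zero_of_dvd_of_eval_eq_zero (RatFunc.denom_div_dvd a b) h)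

theorem polynomial_mem_regularOn (s : Set ℂ) (a : Polynomial ℂ) :
    algebraMap _ (RatFunc ℂ) a ∈ regularOn s := by
  simpa using div_mem_regularOn (s := s) a 1 (by simp)

theorem X_mem_regularOn (s : Set ℂ) : (RatFunc.X : RatFunc ℂ) ∈ regularOn s := by
  rw [← RatFunc.algebraMap_X]; exact polynomial_mem_regularOn s _

theorem C_mem_regularOn (s : Set ℂ) (c : ℂ) : (RatFunc.C c : RatFunc ℂ) ∈ regularOn s := by
  rw [← RatFunc.algebraMap_C]; exact polynomial_mem_regularOn s _

theorem inv_polynomial_mem_regularOn {s : Set ℂ} (b : Polynomial ℂ)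
    (hb : ∀ w ∈ s, b.eval w ≠ 0) : (algebraMap _ (RatFunc ℂ) b)⁻¹ ∈ regularOn s := by
  simpa using div_mem_regularOn (s := s) 1 b hb

theorem evalAt_add {w : ℂ} {f g : RatFunc ℂ} (hf : ¬ HasPoleAt f w) (hg : ¬ HasPoleAt g w) :
    evalAt w (f + g) = evalAt w f + evalAt w g := RatFunc.eval_add _ _ hf hg

theorem evalAt_mul {w : ℂ} {f g : RatFunc ℂ} (hf : ¬ HasPoleAt f w) (hg : ¬ HasPoleAt g w) :
    evalAt w (f * g) = evalAt w f * evalAt w g := RatFunc.eval_mul _ _ hf hg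

theorem evalAt_C (w c : ℂ) : evalAt w (RatFunc.C c) = c := by simp [evalAt]

theorem evalAt_X (w : ℂ) : evalAt w RatFunc.X = w := by simp [evalAt]

theorem evalAt_polynomial (w : ℂ) (a : Polynomial ℂ) :
    evalAt w (algebraMap _ (RatFunc ℂ) a) = a.eval w := by
  simp [evalAt, Polynomial.eval₂_eq_eval_map]

theorem evalAt_eq_div (w : ℂ) (f : RatFunc ℂ) : evalAt w f = f.num.eval w / f.denom.eval w := by
  simp [evalAt, RatFunc.eval, Polynomial.eval₂_eq_eval_map]

/-- Evaluation at a point as a ring homomorphism on the functions that are regular there. -/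
def evalHom (w : ℂ) : regularOn {w} →+* ℂ where
  toFun f := evalAt w f
  map_one' := by simp [evalAt]
  map_zero' := by simp [evalAt]
  map_add' f g := evalAt_add (f.2 w rfl) (g.2 w rfl)
  map_mul' f g := evalAt_mul (f.2 w rfl) (g.2 w rfl)

theorem evalHom_apply {w : ℂ} (f : regularOn {w}) : evalHom w f = evalAt w f := rfl

theorem evalAt_sum {w : ℂ} {ι : Type*} (s : Finset ι) (f : ι → RatFunc ℂ)
    (hf : ∀ i ∈ s, f i ∈ regularOn {w}) :
    evalAt w (∑ i ∈ s, f i) = ∑ i ∈ s, evalAt w (f i) := by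
  have h := map_sum (evalHom w) (fun i : s => (⟨f i, hf i i.2⟩ : regularOn {w})) Finset.univ
  simp only [evalHom_apply, AddSubmonoidClass.coe_finsetSum, Finset.univ_eq_attach] at h
  rwa [Finset.sum_attach s (fun i => f i), Finset.sum_attach s (fun i => evalAt w (f i))] at h

theorem evalAt_sub {w : ℂ} {f g : RatFunc ℂ} (hf : ¬ HasPoleAt f w) (hg : ¬ HasPoleAt g w) :
    evalAt w (f - g) = evalAt w f - evalAt w g :=
  map_sub (evalHom w) ⟨f, by rintro _ rfl; exact hf⟩ ⟨g, by rintro _ rfl; exact hg⟩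

/-! ### The para-conjugate -/

theorem X_ne_zero' : (RatFunc.X : RatFunc ℂ) ≠ 0 := RatFunc.X_ne_zero

/-- `p ↦ conj p (z)` on polynomials. -/
def conjAtZ : Polynomial ℂ →+* RatFunc ℂ :=
  (Polynomial.aeval zVar).toRingHom.comp (Polynomial.mapRingHom (starRingEnd ℂ))

theorem conjAtZ_apply (p : Polynomial ℂ) :
    conjAtZ p = Polynomial.aeval zVar (p.map (starRingEnd ℂ)) := rfl

theorem zVar_mem_regularOn {s : Set ℂ} (hs : (0 : ℂ) ∉ s) : zVar ∈ regularOn s := by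
  unfold zVar
  rw [← RatFunc.algebraMap_X]
  refine inv_polynomial_mem_regularOn _ fun w hw h => hs ?_
  rw [Polynomial.eval_X] at h
  exact h ▸ hw

theorem evalAt_zVar {w : ℂ} (hw : w ≠ 0) : evalAt w zVar = w⁻¹ := by
  have h := evalAt_mul (w := w) (f := zVar) (g := RatFunc.X)
    (zVar_mem_regularOn (s := {w}) (by simpa using hw.symm) w rfl)
    (X_mem_regularOn {w} w rfl)
  rw [zVar, inv_mul_cancel₀ X_ne_zero', evalAt_X] at h
  rw [zVar]
  refine eq_inv_of_mul_eq_one_left ?_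
  rw [← h]
  simp [evalAt]

theorem conjAtZ_mem_regularOn {s : Set ℂ} (hs : (0 : ℂ) ∉ s) (p : Polynomial ℂ) :
    conjAtZ p ∈ regularOn s := by
  induction p using Polynomial.induction_on' with
  | add p q hp hq => rw [map_add]; exact add_mem hp hq
  | monomial n a =>
    rw [conjAtZ_apply, Polynomial.map_monomial, Polynomial.aeval_monomial]
    exact mul_mem (C_mem_regularOn s _) (pow_mem (zVar_mem_regularOn hs) n)

theorem evalAt_conjAtZ {w : ℂ} (hw : w ≠ 0) (p : Polynomial ℂ) :
    evalAt w (conjAtZ p) = (starRingEnd ℂ) (p.eval ((starRingEnd ℂ) w⁻¹)) := by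
  have h0 : (0 : ℂ) ∉ ({w} : Set ℂ) := by simpa using hw.symm
  induction p using Polynomial.induction_on' with
  | add p q hp hq =>
    rw [map_add, evalAt_add (conjAtZ_mem_regularOn h0 p w rfl) (conjAtZ_mem_regularOn h0 q w rfl),
      hp, hq, Polynomial.eval_add, map_add]
  | monomial n a =>
    have h1 := map_mul (evalHom w) ⟨_, C_mem_regularOn {w} ((starRingEnd ℂ) a)⟩
      (⟨_, zVar_mem_regularOn h0⟩ ^ n)
    rw [map_pow] at h1
    simp only [evalHom_apply, Subring.coe_mul, Subring.coe_pow, evalAt_C, evalAt_zVar hw] at h1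
    rw [conjAtZ_apply, Polynomial.map_monomial, Polynomial.aeval_monomial]
    refine h1.trans ?_
    simp

/-- If the image vanishes, then `p` vanishes at every nonzero point, hence has infinitely many
roots. Injectivity is what lets the map extend to fractions. -/
theorem conjAtZ_injective : Function.Injective conjAtZ := by
  rw [injective_iff_map_eq_zero]
  intro p hp
  by_contra hne
  refine hne (Polynomial.eq_zero_of_infinite_isRoot p ?_)
  refine Set.Infinite.mono ?_ (Set.finite_singleton (0 : ℂ)).infinite_compl
  intro w hw
  have hw' : (starRingEnd ℂ) w⁻¹ ≠ 0 := by simpa using hw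
  have := evalAt_conjAtZ hw' p
  rw [hp] at this
  simp [evalAt] at this
  simpa using this.symm

/-- The para-conjugate as a ring homomorphism. -/
def paraConjHom : RatFunc ℂ →+* RatFunc ℂ :=
  RatFunc.liftRingHom conjAtZ
    (nonZeroDivisors_le_comap_nonZeroDivisors_of_injective _ conjAtZ_injective)

theorem paraConjHom_apply (f : RatFunc ℂ) : paraConjHom f = paraConj f := by
  conv_lhs => rw [← RatFunc.num_div_denom f]
  rw [paraConjHom, RatFunc.liftRingHom_apply_div]
  rfl

theorem regular_div {w : ℂ} {f g : RatFunc ℂ} (hf : f ∈ regularOn {w}) (hg : g ∈ regularOn {w})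
    (h : evalAt w g ≠ 0) : f / g ∈ regularOn {w} := by
  rw [div_eq_mul_inv]
  refine mul_mem hf ?_
  rintro _ rfl hp
  have hg0 : g ≠ 0 := by rintro rfl; simp [evalAt] at h
  refine h ?_
  rw [evalAt_eq_div, Polynomial.eval_eq_zero_of_dvd_of_eval_eq_zero (RatFunc.denom_inv_dvd hg0) hp,
    zero_div]

theorem conj_inv_of_norm_one {w : ℂ} (hw : ‖w‖ = 1) : (starRingEnd ℂ) w⁻¹ = w := by
  rw [Complex.inv_def, Complex.normSq_eq_norm_sq, hw]; simp

/-- Para-conjugation reflects points in the unit circle. On the circle the reflection is the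
identity, and para-conjugation becomes pointwise conjugation. -/
theorem paraConj_regular {w : ℂ} (hw : w ≠ 0) {f : RatFunc ℂ}
    (hf : ¬ HasPoleAt f ((starRingEnd ℂ) w⁻¹)) :
    paraConj f ∈ regularOn {w} ∧
      evalAt w (paraConj f) = (starRingEnd ℂ) (evalAt ((starRingEnd ℂ) w⁻¹) f) := by
  have h0 : (0 : ℂ) ∉ ({w} : Set ℂ) := by simpa using hw.symm
  have hd : evalAt w (conjAtZ f.denom) ≠ 0 := by
    rw [evalAt_conjAtZ hw]; exact (map_ne_zero _).2 hf
  have hr : paraConj f ∈ regularOn {w} :=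
    regular_div (conjAtZ_mem_regularOn h0 f.num) (conjAtZ_mem_regularOn h0 f.denom) hd
  refine ⟨hr, ?_⟩
  have hne : conjAtZ f.denom ≠ 0 := by rintro h; rw [h] at hd; simp [evalAt] at hd
  have hmul : paraConj f * conjAtZ f.denom = conjAtZ f.num := div_mul_cancel₀ _ hne
  have := evalAt_mul (hr w rfl) (conjAtZ_mem_regularOn h0 f.denom w rfl)
  rw [hmul] at this
  rw [eq_div_of_mul_eq hd this.symm, evalAt_conjAtZ hw, evalAt_conjAtZ hw, evalAt_eq_div, map_div₀]

theorem paraStar_apply {ι κ : Type*} (M : Matrix ι κ (RatFunc ℂ)) (i : ι) (j : κ) :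
    paraStar M j i = paraConjHom (M i j) := (paraConjHom_apply _).symm

theorem paraStar_mul {ι κ ν : Type*} [Fintype κ] (M : Matrix ι κ (RatFunc ℂ))
    (N : Matrix κ ν (RatFunc ℂ)) : paraStar (M * N) = paraStar N * paraStar M := by
  ext i j
  simp only [paraStar_apply, Matrix.mul_apply, map_sum, map_mul]
  exact Finset.sum_congr rfl fun _ _ => mul_comm _ _

theorem paraStar_one {ι : Type*} [DecidableEq ι] :
    paraStar (1 : Matrix ι ι (RatFunc ℂ)) = 1 := by
  ext i j
  rw [paraStar_apply, Matrix.one_apply, Matrix.one_apply]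
  by_cases h : i = j
  · simp [h]
  · simp [h, Ne.symm h]

theorem det_paraStar {ι : Type*} [DecidableEq ι] [Fintype ι] (M : Matrix ι ι (RatFunc ℂ)) :
    (paraStar M).det = paraConjHom M.det := by
  have : paraStar M = (paraConjHom.mapMatrix M).transpose := by
    ext i j; rw [paraStar_apply]; rfl
  rw [this, Matrix.det_transpose, RingHom.map_det]

/-! ### Restriction to the unit circle -/

/-- The rational functions without poles on the unit circle. -/
abbrev circleRegular : Subring (RatFunc ℂ) := regularOn (Metric.sphere 0 1)

/-- The rational functions without poles in the closed unit disc. -/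
abbrev stableRing : Subring (RatFunc ℂ) := regularOn (Metric.closedBall 0 1)

theorem stableRing_le : stableRing ≤ circleRegular := regularOn_mono Metric.sphere_subset_closedBall

theorem noCirclePoles_iff {ι κ : Type*} {M : Matrix ι κ (RatFunc ℂ)} :
    NoCirclePoles M ↔ ∀ i j, M i j ∈ circleRegular := by
  simp [NoCirclePoles, mem_regularOn]

theorem isStable_iff {ι κ : Type*} {M : Matrix ι κ (RatFunc ℂ)} :
    IsStable M ↔ ∀ i j, M i j ∈ stableRing := by
  simp [IsStable, mem_regularOn]

theorem paraConjHom_mem {f : RatFunc ℂ} (hf : f ∈ circleRegular) :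
    paraConjHom f ∈ circleRegular := by
  intro w hw
  have hw1 : ‖w‖ = 1 := by simpa using hw
  have hw0 : w ≠ 0 := by rintro rfl; simp at hw1
  rw [paraConjHom_apply]
  exact (paraConj_regular hw0 (by rw [conj_inv_of_norm_one hw1]; exact hf w hw)).1 w rfl

theorem norm_toCircle (θ : UnitAddCircle) : ‖(AddCircle.toCircle θ : ℂ)‖ = 1 := Circle.norm_coe _

theorem toCircle_mem (θ : UnitAddCircle) :
    (AddCircle.toCircle θ : ℂ) ∈ Metric.sphere (0 : ℂ) 1 :=
  mem_sphere_zero_iff_norm.2 (norm_toCircle θ)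

theorem not_pole_toCircle {f : RatFunc ℂ} (hf : f ∈ circleRegular) (θ : UnitAddCircle) :
    f ∈ regularOn {(AddCircle.toCircle θ : ℂ)} :=
  regularOn_mono (Set.singleton_subset_iff.2 (toCircle_mem θ)) hf

theorem continuous_onCircle {f : RatFunc ℂ} (hf : f ∈ circleRegular) : Continuous (onCircle f) := by
  have h : onCircle f = fun θ : UnitAddCircle => f.num.eval (AddCircle.toCircle θ : ℂ) /
      f.denom.eval (AddCircle.toCircle θ : ℂ) := by
    funext θ; exact evalAt_eq_div _ _
  rw [h]
  have hc : Continuous fun θ : UnitAddCircle => (AddCircle.toCircle θ : ℂ) :=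
    continuous_subtype_val.comp AddCircle.continuous_toCircle
  exact (f.num.continuous.comp hc).div (f.denom.continuous.comp hc)
    fun θ => hf _ (toCircle_mem θ)

theorem measurable_onCircle (f : RatFunc ℂ) : Measurable (onCircle f) := by
  have h : onCircle f = fun θ : UnitAddCircle => f.num.eval (AddCircle.toCircle θ : ℂ) /
      f.denom.eval (AddCircle.toCircle θ : ℂ) := by
    funext θ; exact evalAt_eq_div _ _
  rw [h]
  have hc : Continuous fun θ : UnitAddCircle => (AddCircle.toCircle θ : ℂ) :=
    continuous_subtype_val.comp AddCircle.continuous_toCircle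
  exact (f.num.continuous.comp hc).measurable.div (f.denom.continuous.comp hc).measurable

/-- The boundary values of a rational function without poles on the circle, as a ring
homomorphism. -/
def circ : circleRegular →+* C(UnitAddCircle, ℂ) where
  toFun f := ⟨onCircle f, continuous_onCircle f.2⟩
  map_one' := by ext θ; simp [onCircle, evalAt]
  map_zero' := by ext θ; simp [onCircle, evalAt]
  map_add' f g := by
    ext θ; exact evalAt_add (not_pole_toCircle f.2 θ _ rfl) (not_pole_toCircle g.2 θ _ rfl)
  map_mul' f g := by
    ext θ; exact evalAt_mul (not_pole_toCircle f.2 θ _ rfl) (not_pole_toCircle g.2 θ _ rfl)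

theorem circ_apply (f : circleRegular) (θ : UnitAddCircle) : circ f θ = onCircle f θ := rfl

/-- The para-conjugate on the rational functions without poles on the circle. -/
def paraConjReg : circleRegular →+* circleRegular :=
  (paraConjHom.comp circleRegular.subtype).codRestrict circleRegular
    fun f => paraConjHom_mem f.2

theorem coe_paraConjReg (f : circleRegular) : (paraConjReg f : RatFunc ℂ) = paraConjHom f := rfl

theorem circ_paraConj (f : circleRegular) : circ (paraConjReg f) = star (circ f) := by
  ext θ
  have hw1 := norm_toCircle θ
  have hw0 : (AddCircle.toCircle θ : ℂ) ≠ 0 := by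
    intro h; rw [h] at hw1; simp at hw1
  have := (paraConj_regular hw0 (f := (f : RatFunc ℂ))
    (by rw [conj_inv_of_norm_one hw1]; exact not_pole_toCircle f.2 θ _ rfl)).2
  rw [conj_inv_of_norm_one hw1] at this
  rw [circ_apply, coe_paraConjReg, paraConjHom_apply]
  exact this

theorem toCircle_injective : Function.Injective
    fun θ : UnitAddCircle => (AddCircle.toCircle θ : ℂ) :=
  Subtype.val_injective.comp (AddCircle.injective_toCircle one_ne_zero)

theorem finite_eval_eq_zero {q : Polynomial ℂ} (hq : q ≠ 0) :
    {θ : UnitAddCircle | q.eval (AddCircle.toCircle θ : ℂ) = 0}.Finite := by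
  refine Set.Finite.preimage toCircle_injective.injOn (s := {w | q.eval w = 0}) ?_
  exact Polynomial.finite_setOfPred_isRoot hq

/-- Makes the finitely many poles and zeros on the circle negligible; needed because filters may
have circle poles. -/
instance : NullSingletonClass (AddCircle.haarAddCircle (T := 1)) := by
  have h : (volume : Measure (AddCircle (1 : ℝ))) = AddCircle.haarAddCircle := by
    rw [AddCircle.volume_eq_smul_haarAddCircle]; simp
  rw [← h]
  refine ⟨fun x => ?_⟩
  rw [← Metric.closedBall_zero, AddCircle.volume_closedBall]
  simp

theorem ae_regular (f : RatFunc ℂ) : ∀ᵐ θ : UnitAddCircle ∂AddCircle.haarAddCircle,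
    f ∈ regularOn {(AddCircle.toCircle θ : ℂ)} := by
  have h := (finite_eval_eq_zero (RatFunc.denom_ne_zero f)).measure_zero
    (AddCircle.haarAddCircle (T := 1))
  filter_upwards [measure_eq_zero_iff_ae_notMem.1 h] with θ hθ
  rintro _ rfl
  exact hθ

theorem eq_zero_of_onCircle_ae_eq_zero {f : RatFunc ℂ}
    (h : ∀ᵐ θ : UnitAddCircle ∂AddCircle.haarAddCircle, onCircle f θ = 0) : f = 0 := by
  by_contra hf
  have h1 := (finite_eval_eq_zero (RatFunc.num_ne_zero hf)).measure_zero
    (AddCircle.haarAddCircle (T := 1))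
  have h2 := (finite_eval_eq_zero (RatFunc.denom_ne_zero f)).measure_zero
    (AddCircle.haarAddCircle (T := 1))
  have : ∀ᵐ θ : UnitAddCircle ∂AddCircle.haarAddCircle, False := by
    filter_upwards [h, measure_eq_zero_iff_ae_notMem.1 h1, measure_eq_zero_iff_ae_notMem.1 h2]
      with θ a b c
    -- Division by zero gives the value `0` at a pole, so the roots of the denominator have to be
    -- excluded along with those of the numerator.
    rw [onCircle, evalAt_eq_div, div_eq_zero_iff] at a
    exact a.elim b c
  exact this.exists.elim fun _ h => h

/-! ### Fourier coefficients on the circle -/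

theorem circ_X_pow (n : ℕ) :
    circ (⟨RatFunc.X, X_mem_regularOn _⟩ ^ n) = fourier (n : ℤ) := by
  rw [map_pow]
  ext θ
  rw [ContinuousMap.pow_apply, circ_apply, fourier_apply, AddCircle.toCircle_zsmul]
  simp [onCircle, evalAt_X]

theorem integral_onCircle_eq_circleAverage (f : RatFunc ℂ) :
    ∫ θ : UnitAddCircle, onCircle f θ ∂AddCircle.haarAddCircle =
      Real.circleAverage (fun w => evalAt w f) 0 1 := by
  have h := fourierCoeff_eq_intervalIntegral (T := 1) (onCircle f) 0 0
  rw [fourierCoeff] at h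
  simp only [neg_zero, fourier_zero, one_smul, zero_add, div_one] at h
  rw [h, Real.circleAverage]
  have h2 := intervalIntegral.integral_comp_mul_left (a := 0) (b := 1)
    (fun x : ℝ => evalAt (circleMap 0 1 x) f) (c := 2 * Real.pi) (by positivity)
  rw [mul_zero, mul_one] at h2
  rw [← h2]
  refine intervalIntegral.integral_congr fun x _ => ?_
  simp only [onCircle]
  congr 1
  rw [AddCircle.toCircle_apply_mk]
  simp [circleMap]

/-- The mean value property of functions holomorphic on the closed disc. -/
theorem integral_onCircle_of_stable {f : RatFunc ℂ} (hf : f ∈ stableRing) :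
    ∫ θ : UnitAddCircle, onCircle f θ ∂AddCircle.haarAddCircle = evalAt 0 f := by
  rw [integral_onCircle_eq_circleAverage]
  refine DiffContOnCl.circleAverage ?_
  have : (fun w => evalAt w f) = fun w => f.num.eval w / f.denom.eval w := by
    funext w; exact evalAt_eq_div w f
  rw [this]
  refine DifferentiableOn.diffContOnCl ?_
  rw [abs_one, closure_ball _ one_ne_zero]
  exact f.num.differentiable.differentiableOn.div f.denom.differentiable.differentiableOn hf

theorem laurentCoeff_eq_integral (f : RatFunc ℂ) (k : ℤ) :
    laurentCoeff f k = ∫ θ : UnitAddCircle, fourier (-k) θ * onCircle f θ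
      ∂AddCircle.haarAddCircle := rfl

/-- The coefficient is the circle mean of `w ^ n * f`, which is again stable. For `n > 0` the value
at `0` vanishes; the case `n = 0` gives the constant term. -/
theorem laurentCoeff_neg_of_stable {f : RatFunc ℂ} (hf : f ∈ stableRing) (n : ℕ) :
    laurentCoeff f (-n) = evalAt 0 (RatFunc.X ^ n * f) := by
  rw [← integral_onCircle_of_stable (mul_mem (pow_mem (X_mem_regularOn _) n) hf),
    laurentCoeff_eq_integral]
  refine integral_congr_ae (Filter.Eventually.of_forall fun θ => ?_)
  have := DFunLike.congr_fun (map_mul circ (⟨RatFunc.X, X_mem_regularOn _⟩ ^ n)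
    ⟨f, stableRing_le hf⟩) θ
  rw [circ_X_pow] at this
  rw [neg_neg]
  exact this.symm

theorem laurentCoeff_of_stable_of_neg {f : RatFunc ℂ} (hf : f ∈ stableRing) {k : ℤ} (hk : k < 0) :
    laurentCoeff f k = 0 := by
  obtain ⟨n, hn⟩ := Int.exists_eq_neg_ofNat hk.le
  have hn0 : n ≠ 0 := by rintro rfl; simp at hn; omega
  have h0 : (0 : ℂ) ∈ Metric.closedBall (0 : ℂ) 1 := by simp
  have hX := pow_mem (X_mem_regularOn (Metric.closedBall 0 1)) n
  rw [hn, laurentCoeff_neg_of_stable hf, evalAt_mul (hX _ h0) (hf _ h0),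
    ← RatFunc.algebraMap_X, ← map_pow, evalAt_polynomial]
  simp [hn0]

theorem laurentCoeff_paraConj (f : circleRegular) (k : ℤ) :
    laurentCoeff (paraConjHom f) k = (starRingEnd ℂ) (laurentCoeff f (-k)) := by
  rw [laurentCoeff_eq_integral, laurentCoeff_eq_integral, ← integral_conj]
  refine integral_congr_ae (Filter.Eventually.of_forall fun θ => ?_)
  have := DFunLike.congr_fun (circ_paraConj f) θ
  simp only [map_mul, ← fourier_neg]
  rw [show onCircle (paraConjHom (f : RatFunc ℂ)) θ = _ from this, neg_neg]
  rfl

/-- The inclusion of the continuous functions into `L²` of the circle. -/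
abbrev toL2 : C(UnitAddCircle, ℂ) →L[ℂ] Lp ℂ 2 (AddCircle.haarAddCircle (T := 1)) :=
  ContinuousMap.toLp 2 AddCircle.haarAddCircle ℂ

theorem norm_toL2_mul_le (a b : C(UnitAddCircle, ℂ)) : ‖toL2 (a * b)‖ ≤ ‖a‖ * ‖toL2 b‖ := by
  refine Lp.norm_le_mul_norm_of_ae_le_mul ?_
  filter_upwards [ContinuousMap.coeFn_toLp (p := 2) (𝕜 := ℂ) AddCircle.haarAddCircle (a * b),
    ContinuousMap.coeFn_toLp (p := 2) (𝕜 := ℂ) AddCircle.haarAddCircle b] with θ h1 h2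
  rw [h1, h2, ContinuousMap.mul_apply, norm_mul]
  exact mul_le_mul_of_nonneg_right (a.norm_coe_le_norm θ) (norm_nonneg _)

theorem repr_toL2 (a : C(UnitAddCircle, ℂ)) (k : ℤ) :
    (fourierBasis (T := 1)).repr (toL2 a) k = fourierCoeff a k := by
  rw [fourierBasis_repr]
  exact fourierCoeff_toLp a k

theorem laurentCoeff_eq (f : circleRegular) (k : ℤ) :
    laurentCoeff f k = (fourierBasis (T := 1)).repr (toL2 (circ f)) k :=
  (repr_toL2 (circ f) k).symm

theorem eq_zero_of_laurentCoeff {f : RatFunc ℂ} (hf : f ∈ circleRegular)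
    (h : ∀ k, laurentCoeff f k = 0) : f = 0 := by
  have h1 : toL2 (circ ⟨f, hf⟩) = 0 := by
    refine (fourierBasis (T := 1)).repr.injective ?_
    rw [map_zero]
    ext k
    rw [← laurentCoeff_eq, h]
    rfl
  refine eq_zero_of_onCircle_ae_eq_zero ?_
  filter_upwards [ContinuousMap.coeFn_toLp (p := 2) (𝕜 := ℂ) AddCircle.haarAddCircle
    (circ ⟨f, hf⟩), Lp.coeFn_zero ℂ 2 (AddCircle.haarAddCircle (T := 1))] with θ h2 h3
  rw [h1, h3] at h2
  exact h2.symm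

/-! ### The Hardy projection -/

/-- Clearing the powers of `z` reverses the coefficients, which turns the para-conjugate of a
fraction into an explicit fraction of polynomials in `w`. -/
theorem X_pow_mul_conjAtZ (N : ℕ) (p : Polynomial ℂ) (hp : p.natDegree ≤ N) :
    RatFunc.X ^ N * conjAtZ p =
      algebraMap _ (RatFunc ℂ) ((p.map (starRingEnd ℂ)).reflect N) := by
  let _ : Invertible zVar := ⟨RatFunc.X, mul_inv_cancel₀ X_ne_zero', inv_mul_cancel₀ X_ne_zero'⟩
  have h := Polynomial.eval₂_reflect_mul_pow (algebraMap ℂ (RatFunc ℂ)) zVar N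
    (p.map (starRingEnd ℂ)) ((Polynomial.natDegree_map_le).trans hp)
  have hX : ⅟zVar = (RatFunc.X : RatFunc ℂ) := rfl
  rw [hX] at h
  have hz : RatFunc.X ^ N * zVar ^ N = 1 := by
    rw [← mul_pow, zVar, mul_inv_cancel₀ X_ne_zero', one_pow]
  rw [conjAtZ_apply, Polynomial.aeval_def, ← h, mul_comm, mul_assoc, mul_comm (zVar ^ N), hz,
    mul_one, ← RatFunc.algebraMap_X, ← Polynomial.aeval_def, Polynomial.aeval_algebraMap_apply,
    Polynomial.aeval_X_left_apply]

/-- The para-conjugate has its poles reflected outside the closed disc, so it is stable, and strict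
properness makes it vanish at `w = 0`. Its coefficients of index `≤ 0` are therefore zero, and
conjugation turns these into the coefficients of index `≥ 0`. -/
theorem laurentCoeff_strictly_proper {p d : Polynomial ℂ} (hd : d.Monic)
    (hroots : ∀ w, d.eval w = 0 → ‖w‖ < 1) (hpd : p.degree < d.degree) {k : ℤ} (hk : 0 ≤ k) :
    laurentCoeff (algebraMap _ (RatFunc ℂ) p / algebraMap _ (RatFunc ℂ) d) k = 0 := by
  set N := d.natDegree
  set A := (p.map (starRingEnd ℂ)).reflect N
  set B := (d.map (starRingEnd ℂ)).reflect N
  have hpN : p.natDegree ≤ N := Polynomial.natDegree_le_natDegree hpd.le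
  have hB0 : ∀ w ∈ Metric.closedBall (0 : ℂ) 1, B.eval w ≠ 0 := by
    intro w hw hBw
    -- At `0` the reversed polynomial takes the conjugate of the leading coefficient of `d`, which
    -- is `1`; elsewhere a root reflects to a root of `d` of modulus at least `1`.
    rcases eq_or_ne w 0 with rfl | hw0
    · rw [← Polynomial.coeff_zero_eq_eval_zero, Polynomial.coeff_reflect] at hBw
      simp [N, hd] at hBw
    · have h0 : (0 : ℂ) ∉ ({w} : Set ℂ) := by simpa using hw0.symm
      have h := evalAt_mul (pow_mem (X_mem_regularOn {w}) N w rfl)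
        (conjAtZ_mem_regularOn h0 d w rfl)
      rw [X_pow_mul_conjAtZ N d le_rfl, evalAt_polynomial, hBw, evalAt_conjAtZ hw0,
        ← RatFunc.algebraMap_X, ← map_pow, evalAt_polynomial] at h
      have h2 := hroots ((starRingEnd ℂ) w⁻¹) (by simpa [hw0] using h.symm)
      rw [RCLike.norm_conj, norm_inv] at h2
      have h3 : ‖w‖ ≤ 1 := by simpa using hw
      exact absurd h2 (not_lt.2 ((one_le_inv₀ (norm_pos_iff.2 hw0)).2 h3))
  have hdc : ∀ w ∈ Metric.sphere (0 : ℂ) 1, d.eval w ≠ 0 := fun w hw h => by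
    have h1 := hroots w h
    rw [mem_sphere_zero_iff_norm.1 hw] at h1
    exact lt_irrefl _ h1
  set f : circleRegular := ⟨_, div_mem_regularOn p d hdc⟩
  have hpara : paraConjHom f = algebraMap _ (RatFunc ℂ) A / algebraMap _ (RatFunc ℂ) B := by
    rw [← X_pow_mul_conjAtZ N p hpN, ← X_pow_mul_conjAtZ N d le_rfl,
      mul_div_mul_left _ _ (pow_ne_zero _ X_ne_zero')]
    exact RatFunc.liftRingHom_apply_div _ _ _ _
  have hst : paraConjHom f ∈ stableRing := by rw [hpara]; exact div_mem_regularOn A B hB0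
  have h0 : (0 : ℂ) ∈ Metric.closedBall (0 : ℂ) 1 := by simp
  have hA0 : evalAt 0 (paraConjHom f) = 0 := by
    have hBne : algebraMap _ (RatFunc ℂ) B ≠ 0 := by
      refine RatFunc.algebraMap_ne_zero ?_
      intro h; exact hB0 0 h0 (by rw [h, Polynomial.eval_zero])
    have h := evalAt_mul (hst 0 h0) (polynomial_mem_regularOn _ B 0 h0)
    rw [hpara, div_mul_cancel₀ _ hBne, evalAt_polynomial, evalAt_polynomial, ← hpara,
      ← Polynomial.coeff_zero_eq_eval_zero, Polynomial.coeff_reflect] at h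
    have h4 : p.coeff N = 0 := Polynomial.coeff_eq_zero_of_degree_lt
      (hpd.trans_le Polynomial.degree_le_natDegree)
    simp only [Polynomial.revAt_zero, Polynomial.coeff_map, h4, map_zero] at h
    exact (mul_eq_zero.1 h.symm).resolve_right (hB0 0 h0)
  obtain ⟨n, rfl⟩ := Int.eq_ofNat_of_zero_le hk
  have h1 := laurentCoeff_paraConj f (-n)
  rw [neg_neg, laurentCoeff_neg_of_stable hst,
    evalAt_mul (pow_mem (X_mem_regularOn (Metric.closedBall 0 1)) n 0 h0) (hst 0 h0), hA0,
    mul_zero] at h1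
  exact (map_eq_zero _).1 h1.symm

/-- Partial fractions. Write the denominator as `d₁ d₂`, with the roots of `d₁` inside and those of
`d₂` outside the circle. A Bézout relation `a d₁ + b d₂ = 1` gives `n / d = n a / d₂ + n b / d₁`.
The first term and the polynomial quotient of `n b` by `d₁` are stable; the remainder over `d₁` is
strictly proper. -/
theorem exists_splitting (f : circleRegular) : ∃ s : circleRegular,
    (s : RatFunc ℂ) ∈ stableRing ∧ ∀ k : ℤ, 0 ≤ k → laurentCoeff (f - s : circleRegular) k = 0 := by
  set n := (f : RatFunc ℂ).num
  set d := (f : RatFunc ℂ).denom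
  have hd0 : d ≠ 0 := RatFunc.denom_ne_zero _
  classical
  set P : ℂ → Polynomial ℂ := fun a => Polynomial.X - Polynomial.C a
  set d₁ := ((d.roots.filter fun a => ‖a‖ < 1).map P).prod
  set d₂ := Polynomial.C d.leadingCoeff * ((d.roots.filter fun a => ¬ ‖a‖ < 1).map P).prod
  have hd : d = d₁ * d₂ := by
    conv_lhs => rw [(IsAlgClosed.splits d).eq_prod_roots,
      ← Multiset.filter_add_not (fun a => ‖a‖ < 1) d.roots, Multiset.map_add, Multiset.prod_add]
    simp only [d₁, d₂, P]
    ring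
  have hroot : ∀ (s : Multiset ℂ) (w : ℂ), ((s.map P).prod).eval w = 0 → w ∈ s := by
    intro s w h
    rw [Polynomial.eval_multiset_prod, Multiset.prod_eq_zero_iff] at h
    simp only [Multiset.map_map, Multiset.mem_map, Function.comp_apply, P, Polynomial.eval_sub,
      Polynomial.eval_X, Polynomial.eval_C, sub_eq_zero] at h
    obtain ⟨a, ha, rfl⟩ := h
    exact ha
  have h1 : ∀ w, d₁.eval w = 0 → ‖w‖ < 1 := fun w h => by
    simpa using (Multiset.mem_filter.1 (hroot _ w h)).2
  have hlc : d.leadingCoeff ≠ 0 := Polynomial.leadingCoeff_ne_zero.2 hd0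
  have h2 : ∀ w, d₂.eval w = 0 → 1 < ‖w‖ := fun w h => by
    rw [Polynomial.eval_mul, Polynomial.eval_C, mul_eq_zero, or_iff_right hlc] at h
    obtain ⟨h3, h4⟩ := Multiset.mem_filter.1 (hroot _ w h)
    refine lt_of_le_of_ne (not_lt.1 h4) fun h5 => ?_
    exact f.2 w (by simpa using h5.symm) (Polynomial.isRoot_of_mem_roots h3)
  have hm : d₁.Monic := Polynomial.monic_multiset_prod_of_monic _ _
    fun a _ => Polynomial.monic_X_sub_C a
  have hd2 : d₂ ≠ 0 := by rintro h; rw [h, mul_zero] at hd; exact hd0 hd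
  have hcop : IsCoprime d₁ d₂ := by
    refine (Polynomial.isCoprime_iff_aeval_ne_zero_of_isAlgClosed ℂ ℂ d₁ d₂).2 fun w => ?_
    by_contra! h
    exact lt_asymm (h1 w (by simpa using h.1)) (h2 w (by simpa using h.2))
  obtain ⟨a, b, hab⟩ := hcop
  set s : RatFunc ℂ := algebraMap _ (RatFunc ℂ) (n * a) / algebraMap _ (RatFunc ℂ) d₂ +
    algebraMap _ (RatFunc ℂ) ((n * b) /ₘ d₁)
  have hs : s ∈ stableRing := add_mem
    (div_mem_regularOn _ _ fun w hw h => absurd (h2 w h) (not_lt.2 (by simpa using hw)))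
    (polynomial_mem_regularOn _ _)
  refine ⟨⟨s, stableRing_le hs⟩, hs, fun k hk => ?_⟩
  have hfs : (f : RatFunc ℂ) - s =
      algebraMap _ (RatFunc ℂ) ((n * b) %ₘ d₁) / algebraMap _ (RatFunc ℂ) d₁ := by
    have e1 : (algebraMap _ (RatFunc ℂ) d₁) ≠ 0 := RatFunc.algebraMap_ne_zero hm.ne_zero
    have e2 : (algebraMap _ (RatFunc ℂ) d₂) ≠ 0 := RatFunc.algebraMap_ne_zero hd2
    have e3 := congrArg (algebraMap _ (RatFunc ℂ)) (Polynomial.modByMonic_add_div (n * b) d₁)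
    have e4 := congrArg (algebraMap _ (RatFunc ℂ)) hab
    rw [← RatFunc.num_div_denom (f : RatFunc ℂ)]
    change algebraMap _ (RatFunc ℂ) n / algebraMap _ (RatFunc ℂ) d - s = _
    simp only [s, hd, map_add, map_mul, map_one] at e3 e4 ⊢
    field_simp
    linear_combination (-(algebraMap _ (RatFunc ℂ) n)) * e4 - algebraMap _ (RatFunc ℂ) d₂ * e3
  change laurentCoeff ((f : RatFunc ℂ) - s) k = 0
  rw [hfs]
  exact laurentCoeff_strictly_proper hm h1 (Polynomial.degree_modByMonic_lt _ hm) hk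

/-! ### Approximate inverses of polynomials -/

theorem norm_cesaro (N : ℕ) (c : ℂ) (hc : ‖c‖ = 1) :
    ‖toL2 (∑ k ∈ Finset.range N, c ^ (k + 1) • fourier ((k + 1 : ℕ) : ℤ))‖ = √N := by
  have ho : Orthonormal ℂ fun k : ℕ => fourierLp (T := 1) 2 ((k + 1 : ℕ) : ℤ) :=
    orthonormal_fourier.comp (fun k : ℕ => ((k + 1 : ℕ) : ℤ)) fun a b h => by simpa using h
  have h1 : toL2 (∑ k ∈ Finset.range N, c ^ (k + 1) • fourier ((k + 1 : ℕ) : ℤ)) =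
      ∑ k ∈ Finset.range N, c ^ (k + 1) • fourierLp (T := 1) 2 ((k + 1 : ℕ) : ℤ) := by
    rw [map_sum]; simp only [map_smul]
  have h2 := ho.inner_sum (fun k => c ^ (k + 1)) (fun k => c ^ (k + 1)) (Finset.range N)
  rw [← h1, inner_self_eq_norm_sq_to_K] at h2
  simp only [RCLike.conj_mul, norm_pow, hc, one_pow, Finset.sum_const, Finset.card_range,
    nsmul_eq_mul, mul_one, map_one] at h2
  rw [eq_comm, Real.sqrt_eq_iff_mul_self_eq (by positivity) (norm_nonneg _)]
  rw [← sq]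
  refine Complex.ofReal_injective ?_
  rw [Complex.ofReal_natCast, Complex.ofReal_pow]
  exact h2.symm

/-- Off the circle the exact inverse serves. For `‖a‖ = 1`, a Cesàro mean of the partial sums of the
geometric series of `1 / (w - a)` serves: the error is the average of `M` orthonormal functions with
unimodular coefficients, of norm `1 / √M`. -/
theorem exists_linear_mul_approx_one (a : ℂ) (ε : ℝ) (hε : 0 < ε) :
    ∃ q : circleRegular,
      ‖toL2 (circ (q * ⟨_, polynomial_mem_regularOn _ (Polynomial.X - Polynomial.C a)⟩) - 1)‖ < ε ∧
      (1 ≤ ‖a‖ → (q : RatFunc ℂ) ∈ stableRing) := by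
  rcases ne_or_eq ‖a‖ 1 with ha | ha
  · have hr : ∀ w, (Polynomial.X - Polynomial.C a).eval w = 0 → w = a := fun w h => by
      simpa [sub_eq_zero] using h
    refine ⟨⟨_, inv_polynomial_mem_regularOn (Polynomial.X - Polynomial.C a) ?_⟩, ?_, fun h1 => ?_⟩
    · intro w hw h
      rw [hr w h] at hw
      exact ha (by simpa using hw)
    · convert hε using 1
      rw [norm_eq_zero]
      refine (congrArg toL2 ?_).trans (map_zero toL2)
      rw [sub_eq_zero, ← map_one circ]
      congr 1
      refine Subtype.ext (inv_mul_cancel₀ ?_)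
      exact RatFunc.algebraMap_ne_zero (Polynomial.X_sub_C_ne_zero a)
    · refine inv_polynomial_mem_regularOn _ fun w hw h => ?_
      rw [hr w h] at hw
      exact ha (le_antisymm (by simpa using hw) h1)
  · have ha0 : a ≠ 0 := by rintro rfl; simp at ha
    obtain ⟨M, hM⟩ := exists_nat_gt (1 / ε ^ 2)
    have hM0 : (0 : ℝ) < M := lt_trans (by positivity) hM
    have hMne : (M : ℂ) ≠ 0 := by exact_mod_cast hM0.ne'
    set u : Polynomial ℂ := Polynomial.C a⁻¹ * Polynomial.X
    set q : Polynomial ℂ := -(Polynomial.C a⁻¹ * Polynomial.C (M : ℂ)⁻¹ *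
      ∑ k ∈ Finset.range M, ∑ i ∈ Finset.range (k + 1), u ^ i)
    have hq : q * (Polynomial.X - Polynomial.C a) - 1 =
        -(Polynomial.C (M : ℂ)⁻¹ * ∑ k ∈ Finset.range M, u ^ (k + 1)) := by
      have e1 : Polynomial.C a⁻¹ * (Polynomial.X - Polynomial.C a) = -(1 - u) := by
        rw [mul_sub, ← Polynomial.C_mul, inv_mul_cancel₀ ha0, Polynomial.C_1, neg_sub]
      have e2 : (1 - u) * ∑ k ∈ Finset.range M, ∑ i ∈ Finset.range (k + 1), u ^ i =
          M - ∑ k ∈ Finset.range M, u ^ (k + 1) := by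
        rw [Finset.mul_sum]
        simp only [mul_neg_geom_sum, Finset.sum_sub_distrib]
        simp
      have e3 : Polynomial.C (M : ℂ)⁻¹ * (M : Polynomial ℂ) = 1 := by
        rw [← Polynomial.C_eq_natCast, ← Polynomial.C_mul, inv_mul_cancel₀ hMne, Polynomial.C_1]
      simp only [q]
      linear_combination (-(Polynomial.C (M : ℂ)⁻¹ *
        ∑ k ∈ Finset.range M, ∑ i ∈ Finset.range (k + 1), u ^ i)) * e1 +
        Polynomial.C (M : ℂ)⁻¹ * e2 + e3
    refine ⟨⟨_, polynomial_mem_regularOn _ q⟩, ?_, fun _ => polynomial_mem_regularOn _ q⟩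
    have hcirc : circ (⟨_, polynomial_mem_regularOn _ q⟩ *
        ⟨_, polynomial_mem_regularOn _ (Polynomial.X - Polynomial.C a)⟩) - 1 =
        (-(M : ℂ)⁻¹) • ∑ k ∈ Finset.range M, a⁻¹ ^ (k + 1) • fourier ((k + 1 : ℕ) : ℤ) := by
      ext θ
      have h1 := congrArg (Polynomial.eval (AddCircle.toCircle θ : ℂ)) hq
      have h2 : circ (⟨_, polynomial_mem_regularOn _ q⟩ *
          ⟨_, polynomial_mem_regularOn _ (Polynomial.X - Polynomial.C a)⟩) θ =
          (q * (Polynomial.X - Polynomial.C a)).eval (AddCircle.toCircle θ : ℂ) := by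
        rw [← evalAt_polynomial, map_mul (algebraMap _ _)]
        rfl
      rw [ContinuousMap.sub_apply, h2, ContinuousMap.one_apply, ContinuousMap.smul_apply,
        ContinuousMap.sum_apply]
      rw [Polynomial.eval_sub, Polynomial.eval_one] at h1
      rw [h1]
      simp only [u, Polynomial.eval_neg, Polynomial.eval_mul, Polynomial.eval_C,
        Polynomial.eval_finsetSum, Polynomial.eval_pow, Polynomial.eval_X, mul_pow,
        ContinuousMap.smul_apply, smul_eq_mul, fourier_apply, AddCircle.toCircle_zsmul, neg_mul,
        zpow_natCast, Circle.coe_pow]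
    rw [hcirc, map_smul, norm_smul, norm_cesaro M a⁻¹ (by rw [norm_inv, ha, inv_one]), norm_neg,
      norm_inv, Complex.norm_natCast, inv_mul_eq_div, Real.sqrt_div_self', ← Real.sqrt_one,
      ← Real.sqrt_div zero_le_one, Real.sqrt_lt' hε]
    rw [div_lt_comm₀ hM0 (by positivity)]
    exact hM

theorem exists_prod_mul_approx_one (s : Multiset ℂ) : ∀ ε : ℝ, 0 < ε →
    ∃ q : circleRegular,
      ‖toL2 (circ (q * ⟨_, polynomial_mem_regularOn _
        (s.map fun a => Polynomial.X - Polynomial.C a).prod⟩) - 1)‖ < ε ∧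
      ((∀ a ∈ s, 1 ≤ ‖a‖) → (q : RatFunc ℂ) ∈ stableRing) := by
  induction s using Multiset.induction_on with
  | empty =>
    intro ε hε
    refine ⟨1, ?_, fun _ => one_mem _⟩
    convert hε using 1
    rw [norm_eq_zero]
    refine (congrArg toL2 ?_).trans (map_zero toL2)
    rw [sub_eq_zero, ← map_one circ]
    congr 1
    refine Subtype.ext ?_
    simp
  | cons a s ih =>
    intro ε hε
    obtain ⟨q₁, h₁, hs₁⟩ := ih (ε / 2) (by positivity)
    set D₁ : circleRegular := ⟨_, polynomial_mem_regularOn _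
        (s.map fun a => Polynomial.X - Polynomial.C a).prod⟩
    set A := circ (q₁ * D₁)
    -- The new factor is chosen after `q₁`, since its `L²` error is magnified by the sup norm of `q₁
    -- D₁`.
    obtain ⟨q₂, h₂, hs₂⟩ := exists_linear_mul_approx_one a (ε / 2 / (‖A‖ + 1)) (by positivity)
    set D₂ : circleRegular := ⟨_, polynomial_mem_regularOn _ (Polynomial.X - Polynomial.C a)⟩
    refine ⟨q₁ * q₂, ?_, fun h => mul_mem (hs₁ fun b hb => h b (Multiset.mem_cons_of_mem hb))
      (hs₂ (h a (Multiset.mem_cons_self a s)))⟩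
    have hD : (⟨_, polynomial_mem_regularOn _ ((a ::ₘ s).map
        fun a => Polynomial.X - Polynomial.C a).prod⟩ : circleRegular) = D₂ * D₁ := by
      refine Subtype.ext ?_
      simp [D₁, D₂]
    rw [hD]
    have he : circ (q₁ * q₂ * (D₂ * D₁)) - 1 = A * (circ (q₂ * D₂) - 1) + (A - 1) := by
      simp only [A, map_mul]; ring
    rw [he, map_add]
    refine (norm_add_le _ _).trans_lt ?_
    have h3 := norm_toL2_mul_le A (circ (q₂ * D₂) - 1)
    have h4 : ‖A‖ * ‖toL2 (circ (q₂ * D₂) - 1)‖ ≤ ‖A‖ * (ε / 2 / (‖A‖ + 1)) :=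
      mul_le_mul_of_nonneg_left h₂.le (norm_nonneg _)
    have h5 : ‖A‖ * (ε / 2 / (‖A‖ + 1)) ≤ ε / 2 := by
      rw [← mul_div_assoc, div_le_iff₀ (by positivity)]
      nlinarith [norm_nonneg A]
    linarith

/-- The scalar form of outerness: without zeros in the open disc, `d` has approximate inverses that
are causal. The version without causality handles filters with arbitrary poles. -/
theorem exists_mul_approx_one (d : Polynomial ℂ) (hd : d ≠ 0) (ε : ℝ) (hε : 0 < ε) :
    ∃ q : circleRegular,
      ‖toL2 (circ (q * ⟨_, polynomial_mem_regularOn _ d⟩) - 1)‖ < ε ∧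
      ((∀ w, ‖w‖ < 1 → d.eval w ≠ 0) → (q : RatFunc ℂ) ∈ stableRing) := by
  obtain ⟨q, hq, hs⟩ := exists_prod_mul_approx_one d.roots ε hε
  refine ⟨q * ⟨_, C_mem_regularOn _ d.leadingCoeff⁻¹⟩, ?_, fun h => mul_mem (hs fun a ha => ?_)
    (C_mem_regularOn _ _)⟩
  · convert hq using 5
    refine Subtype.ext ?_
    have hlc : RatFunc.C d.leadingCoeff ≠ 0 := by simpa using hd
    have e := congrArg (algebraMap _ (RatFunc ℂ)) (IsAlgClosed.splits d).eq_prod_roots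
    rw [map_mul, RatFunc.algebraMap_C] at e
    simp only [Subring.coe_mul, map_inv₀]
    rw [e]
    field_simp
  · by_contra! h1
    exact h a h1 (Polynomial.isRoot_of_mem_roots ha)

/-! ### Spectral representation of processes driven by white noise. -/

section Synthesis

variable {Ω : Type*} [MeasurableSpace Ω] {P : Measure Ω} {κ : Type*} {e : RandomSeq P κ}

theorem orthonormal_noise (he : IsNormalizedWhiteNoise e) (j : κ) :
    Orthonormal ℂ fun k : ℤ => e (-k) j :=
  he.2.comp (fun k : ℤ => (-k, j)) fun a b h => by simpa using h

/-- The spectral representation of a white noise component: the isometry that maps `w ^ k` to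
`e (-k) j`. -/
def noiseIsometry (he : IsNormalizedWhiteNoise e) (j : κ) :
    Lp ℂ 2 (AddCircle.haarAddCircle (T := 1)) →ₗᵢ[ℂ] Lp ℂ 2 P :=
  (orthonormal_noise he j).orthogonalFamily.linearIsometry.comp
    (fourierBasis (T := 1)).repr.toLinearIsometry

theorem hasSum_noiseIsometry (he : IsNormalizedWhiteNoise e) (j : κ)
    (a : Lp ℂ 2 (AddCircle.haarAddCircle (T := 1))) :
    HasSum (fun k : ℤ => (fourierBasis (T := 1)).repr a k • e (-k) j) (noiseIsometry he j a) :=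
  (orthonormal_noise he j).orthogonalFamily.hasSum_linearIsometry _

theorem noiseIsometry_fourier (he : IsNormalizedWhiteNoise e) (j : κ) (k : ℤ) :
    noiseIsometry he j (toL2 (fourier k)) = e (-k) j := by
  have h1 : toL2 (fourier k) = fourierBasis (T := 1) k := by rw [coe_fourierBasis]
  refine (hasSum_noiseIsometry he j _).unique ?_
  convert hasSum_single k ?_ using 1
  · rw [h1, HilbertBasis.repr_self]; simp
  · intro n hn
    rw [h1, HilbertBasis.repr_self]
    simp [hn]

theorem inner_noiseIsometry_of_ne (he : IsNormalizedWhiteNoise e) {i j : κ} (hij : i ≠ j)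
    (a b : Lp ℂ 2 (AddCircle.haarAddCircle (T := 1))) :
    inner ℂ (noiseIsometry he i a) (noiseIsometry he j b) = 0 := by
  have h1 : ∀ k, inner ℂ (noiseIsometry he i a) (e k j) = 0 := by
    intro k
    rw [← inner_conj_symm]
    have := (hasSum_noiseIsometry he i a).mapL (innerSL ℂ (e k j))
    simp only [map_smul, innerSL_apply_apply] at this
    rw [map_eq_zero]
    refine this.unique ?_
    convert hasSum_zero using 2 with n
    have h2 := he.2.2 (i := (k, j)) (j := (-n, i)) (by simp [hij.symm])
    rw [h2, smul_zero]
  have := (hasSum_noiseIsometry he j b).mapL (innerSL ℂ (noiseIsometry he i a))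
  simp only [map_smul, innerSL_apply_apply] at this
  refine this.unique ?_
  convert hasSum_zero using 2 with n
  rw [h1, smul_zero]

variable [Fintype κ]

/-- The random variable at time `t` of the process with transfer row `h` driven by `e`. -/
def synth (he : IsNormalizedWhiteNoise e) (t : ℤ) :
    (κ → C(UnitAddCircle, ℂ)) →ₗ[ℂ] Lp ℂ 2 P where
  toFun h := ∑ j, noiseIsometry he j (toL2 (fourier (-t) * h j))
  map_add' h g := by simp only [Pi.add_apply, mul_add, map_add, Finset.sum_add_distrib]
  map_smul' c h := by
    simp only [Pi.smul_apply, mul_smul_comm, map_smul, RingHom.id_apply, Finset.smul_sum]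

theorem synth_apply (he : IsNormalizedWhiteNoise e) (t : ℤ) (h : κ → C(UnitAddCircle, ℂ)) :
    synth he t h = ∑ j, noiseIsometry he j (toL2 (fourier (-t) * h j)) := rfl

theorem fourier_add_mul (k l : ℤ) :
    (fourier k : C(UnitAddCircle, ℂ)) * fourier l = fourier (k + l) := by
  ext θ; rw [ContinuousMap.mul_apply, fourier_add]

theorem synth_sub (he : IsNormalizedWhiteNoise e) (t k : ℤ) (h : κ → C(UnitAddCircle, ℂ)) :
    synth he (t - k) h = synth he t (fun j => fourier k * h j) := by
  simp only [synth_apply, ← mul_assoc, fourier_add_mul]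
  rw [show -(t - k) = -t + k by ring]

theorem synth_single [DecidableEq κ] (he : IsNormalizedWhiteNoise e) (t : ℤ) (j : κ) :
    synth he t (Pi.single j 1) = e t j := by
  rw [synth_apply, Finset.sum_eq_single j]
  · rw [Pi.single_eq_same, mul_one, noiseIsometry_fourier, neg_neg]
  · intro i _ hi
    rw [Pi.single_eq_of_ne hi, mul_zero, map_zero, map_zero]
  · simp

theorem inner_toL2_fourier_mul (k : ℤ) (a b : C(UnitAddCircle, ℂ)) :
    inner ℂ (toL2 (fourier k * a)) (toL2 (fourier k * b)) = inner ℂ (toL2 a) (toL2 b) := by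
  rw [ContinuousMap.inner_toLp, ContinuousMap.inner_toLp]
  refine integral_congr_ae (Filter.Eventually.of_forall fun θ => ?_)
  have h : (fourier k θ : ℂ) * (starRingEnd ℂ) (fourier k θ) = 1 := by
    rw [RCLike.mul_conj, fourier_apply, Circle.norm_coe]; simp
  simp only [ContinuousMap.mul_apply, map_mul]
  linear_combination (b θ * (starRingEnd ℂ) (a θ)) * h

theorem inner_synth (he : IsNormalizedWhiteNoise e) (t : ℤ) (h g : κ → C(UnitAddCircle, ℂ)) :
    inner ℂ (synth he t h) (synth he t g) = ∑ j, inner ℂ (toL2 (h j)) (toL2 (g j)) := by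
  rw [synth_apply, synth_apply, sum_inner]
  refine Finset.sum_congr rfl fun j _ => ?_
  rw [inner_sum, Finset.sum_eq_single j]
  · rw [LinearIsometry.inner_map_map, inner_toL2_fourier_mul]
  · intro i _ hi
    exact inner_noiseIsometry_of_ne he hi.symm _ _
  · simp

theorem norm_synth_sq (he : IsNormalizedWhiteNoise e) (t : ℤ) (h : κ → C(UnitAddCircle, ℂ)) :
    ‖synth he t h‖ ^ 2 = ∑ j, ‖toL2 (h j)‖ ^ 2 := by
  have h1 := inner_synth he t h h
  simp only [inner_self_eq_norm_sq_to_K] at h1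
  exact_mod_cast h1

/-- The scalar factor enters through its `L²` norm and the row only through sup norms, so
multipliers need to be close to `1` in `L²` only. -/
theorem norm_synth_mul_le (he : IsNormalizedWhiteNoise e) (t : ℤ) (a : C(UnitAddCircle, ℂ))
    (h : κ → C(UnitAddCircle, ℂ)) :
    ‖synth he t (fun j => a * h j)‖ ≤ (∑ j, ‖h j‖) * ‖toL2 a‖ := by
  rw [synth_apply, Finset.sum_mul]
  refine (norm_sum_le _ _).trans (Finset.sum_le_sum fun j _ => ?_)
  rw [LinearIsometry.norm_map, show fourier (-t) * (a * h j) = (fourier (-t) * h j) * a by ring]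
  refine (norm_toL2_mul_le _ _).trans (mul_le_mul_of_nonneg_right ?_ (norm_nonneg _))
  refine (norm_mul_le _ _).trans_eq ?_
  rw [fourier_norm, one_mul]

/-- The Fourier partial sums of `g` stay in `K` after synthesis and converge in `L²`, which suffices
by `norm_synth_mul_le`. Taking `I` to be the nonnegative integers encodes causality. -/
theorem synth_mul_mem (he : IsNormalizedWhiteNoise e) (t : ℤ) {K : Submodule ℂ (Lp ℂ 2 P)}
    (hK : IsClosed (K : Set (Lp ℂ 2 P))) (I : Set ℤ) (h : κ → C(UnitAddCircle, ℂ))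
    (hI : ∀ k ∈ I, synth he t (fun j => fourier k * h j) ∈ K) (g : C(UnitAddCircle, ℂ))
    (hg : ∀ k ∉ I, fourierCoeff g k = 0) : synth he t (fun j => g * h j) ∈ K := by
  set s : Finset ℤ → C(UnitAddCircle, ℂ) := fun F => ∑ k ∈ F, fourierCoeff g k • fourier k
  have hs : Filter.Tendsto (fun F => toL2 (s F)) Filter.atTop (nhds (toL2 g)) := by
    have h1 := hasSum_fourier_series_L2 (T := 1) (toL2 g)
    have h2 : (fun F => toL2 (s F)) = fun F => ∑ k ∈ F, fourierCoeff (toL2 g) k • fourierLp 2 k := by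
      funext F
      simp only [s, map_sum, map_smul]
      refine Finset.sum_congr rfl fun k _ => ?_
      rw [fourierCoeff_toLp]
    rw [h2]
    exact h1
  have hmem : ∀ F, synth he t (fun j => s F * h j) ∈ K := by
    intro F
    have h1 : (fun j => s F * h j) = ∑ k ∈ F, fourierCoeff g k • fun j => fourier k * h j := by
      funext j
      simp only [s, Finset.sum_mul, Finset.sum_apply, Pi.smul_apply, smul_mul_assoc]
    rw [h1, map_sum]
    refine sum_mem fun k _ => ?_
    by_cases hk : k ∈ I
    · rw [map_smul]; exact K.smul_mem _ (hI k hk)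
    · rw [map_smul, hg k hk, zero_smul]; exact K.zero_mem
  refine hK.mem_of_tendsto (b := Filter.atTop) (f := fun F => synth he t (fun j => s F * h j)) ?_
    (Filter.Eventually.of_forall hmem)
  rw [tendsto_iff_norm_sub_tendsto_zero] at hs ⊢
  refine squeeze_zero (fun _ => norm_nonneg _) (fun F => ?_)
    (by simpa using hs.const_mul (∑ j, ‖h j‖))
  rw [← map_sub, ← map_sub toL2]
  refine le_trans (le_of_eq ?_) (norm_synth_mul_le he t (s F - g) h)
  congr 2
  funext j
  simp only [Pi.sub_apply, sub_mul]

/-- Membership of `S(z) e(t)` in a closed subspace that contains the `w ^ k G(z) e(t)`, `k ∈ I`,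
when `S` is approximately a combination of the rows of `G` with coefficients supported in `I`. -/
theorem synth_mem_of_approx {κ' : Type*} [Fintype κ'] (he : IsNormalizedWhiteNoise e) (t : ℤ)
    {K : Submodule ℂ (Lp ℂ 2 P)} (hK : IsClosed (K : Set (Lp ℂ 2 P))) (I : Set ℤ)
    (G : Matrix κ' κ circleRegular) (S : κ → circleRegular)
    (hI : ∀ k ∈ I, ∀ i, synth he t (fun j => fourier k * circ (G i j)) ∈ K)
    (happ : ∀ ε > 0, ∃ (q : circleRegular) (g : κ' → circleRegular),
      ‖toL2 (circ q - 1)‖ < ε ∧ (∀ i, ∀ k ∉ I, laurentCoeff (g i) k = 0) ∧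
      ∀ j, ∑ i, g i * G i j = q * S j) :
    synth he t (fun j => circ (S j)) ∈ K := by
  rw [← SetLike.mem_coe, ← hK.closure_eq, Metric.mem_closure_iff]
  intro ε hε
  set C := ∑ j, ‖circ (S j)‖
  have hC : 0 ≤ C := Finset.sum_nonneg fun _ _ => norm_nonneg _
  obtain ⟨q, g, h1, h2, h3⟩ := happ (ε / (C + 1)) (by positivity)
  refine ⟨synth he t fun j => circ (q * S j), ?_, ?_⟩
  · have h4 : (fun j => circ (q * S j)) = ∑ i, fun j => circ (g i) * circ (G i j) := by
      funext j
      rw [← h3, map_sum, Finset.sum_apply]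
      simp only [map_mul]
    rw [SetLike.mem_coe, h4, map_sum]
    refine sum_mem fun i _ => ?_
    exact synth_mul_mem he t hK I _ (fun k hk => hI k hk i) _ (h2 i)
  · rw [dist_comm, dist_eq_norm, ← map_sub]
    have h5 : (fun j => circ (q * S j)) - (fun j => circ (S j)) =
        fun j => (circ q - 1) * circ (S j) := by
      funext j
      simp only [Pi.sub_apply, map_mul, sub_mul, one_mul]
    rw [h5]
    refine (norm_synth_mul_le he t _ _).trans_lt ?_
    have h6 : C * ‖toL2 (circ q - 1)‖ ≤ C * (ε / (C + 1)) := mul_le_mul_of_nonneg_left h1.le hC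
    refine h6.trans_lt ?_
    rw [← mul_div_assoc, div_lt_iff₀ (by positivity)]
    nlinarith

theorem lintegral_sum_norm_sq (he : IsNormalizedWhiteNoise e) (t : ℤ)
    (h : κ → C(UnitAddCircle, ℂ)) :
    ∫⁻ θ : UnitAddCircle, ENNReal.ofReal (∑ l, ‖h l θ‖ ^ 2) ∂AddCircle.haarAddCircle =
      ENNReal.ofReal (‖synth he t h‖ ^ 2) := by
  have hc : Continuous fun θ : UnitAddCircle => ∑ l, ‖h l θ‖ ^ 2 := by fun_prop
  have hi : ∀ {F : UnitAddCircle → ℝ}, Continuous F → Integrable F AddCircle.haarAddCircle :=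
    fun hF => hF.integrable_of_hasCompactSupport (HasCompactSupport.of_compactSpace _)
  rw [← ofReal_integral_eq_lintegral_ofReal (hi hc)
    (Filter.Eventually.of_forall fun θ => by positivity), norm_synth_sq,
    integral_finsetSum _ fun l _ => hi (by fun_prop)]
  congr 1
  refine Finset.sum_congr rfl fun l _ => ?_
  have h1 := ContinuousMap.inner_toLp (𝕜 := ℂ) AddCircle.haarAddCircle (h l) (h l)
  rw [inner_self_eq_norm_sq_to_K] at h1
  have h2 : (fun θ => h l θ * (starRingEnd ℂ) (h l θ)) = fun θ => ((‖h l θ‖ ^ 2 : ℝ) : ℂ) := by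
    funext θ; rw [RCLike.mul_conj]; push_cast; rfl
  rw [h2, integral_complex_ofReal] at h1
  refine Complex.ofReal_injective (h1.symm.trans ?_)
  rw [Complex.ofReal_pow]
  rfl

end Synthesis

/-! ### Filters -/

/-- The underlying rational matrix. -/
abbrev toRat {κ κ' : Type*} (G : Matrix κ κ' circleRegular) : Matrix κ κ' (RatFunc ℂ) :=
  G.map circleRegular.subtype

theorem exists_toRat {κ κ' : Type*} {M : Matrix κ κ' (RatFunc ℂ)}
    (hM : ∀ i j, M i j ∈ circleRegular) : ∃ G : Matrix κ κ' circleRegular, M = toRat G :=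
  ⟨fun i j => ⟨M i j, hM i j⟩, rfl⟩

/-- The row of Laurent polynomials as a row of continuous functions. -/
def laurentRowC {κ' : Type*} [DecidableEq κ'] (c : ℤ × κ' →₀ ℂ) (j : κ') : C(UnitAddCircle, ℂ) :=
  c.sum fun q a => if q.2 = j then a • fourier q.1 else 0

theorem laurentRowC_apply {κ' : Type*} [DecidableEq κ'] (c : ℤ × κ' →₀ ℂ) (j : κ') (θ : UnitAddCircle) :
    laurentRowC c j θ = laurentRow c θ j := by
  rw [laurentRowC, laurentRow, Finsupp.sum, Finsupp.sum, ContinuousMap.sum_apply]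
  refine Finset.sum_congr rfl fun q _ => ?_
  split_ifs <;> simp

section Filters

variable {Ω : Type*} [MeasurableSpace Ω] {P : Measure Ω} {κ κ' : Type*} {e : RandomSeq P κ}
  [Fintype κ] [Fintype κ'] [DecidableEq κ']

theorem laurentApply_eq_synth (he : IsNormalizedWhiteNoise e) (G : Matrix κ' κ circleRegular)
    (u : RandomSeq P κ') (hu : ∀ t i, u t i = synth he t fun j => circ (G i j))
    (c : ℤ × κ' →₀ ℂ) (t : ℤ) :
    laurentApply c u t = synth he t fun j => ∑ i, laurentRowC c i * circ (G i j) := by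
  have h : (fun j => ∑ i, laurentRowC c i * circ (G i j)) =
      ∑ q ∈ c.support, c q • fun j => fourier q.1 * circ (G q.2 j) := by
    funext j
    simp only [laurentRowC, Finsupp.sum, Finset.sum_mul, Finset.sum_apply, Pi.smul_apply]
    rw [Finset.sum_comm]
    refine Finset.sum_congr rfl fun q _ => ?_
    simp only [ite_mul, zero_mul, Finset.sum_ite_eq, Finset.mem_univ, if_true, smul_mul_assoc]
  rw [h, map_sum, laurentApply, Finsupp.sum]
  refine Finset.sum_congr rfl fun q _ => ?_
  rw [map_smul, hu, synth_sub]

/-- Pointwise, `a (G G*) a*` is the squared length of `a G`. The identity is needed only off the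
finitely many circle poles of `f`. -/
theorem spectralDist_eq (G : Matrix κ' κ circleRegular) (f : κ' → RatFunc ℂ)
    (c : ℤ × κ' →₀ ℂ) :
    spectralDist (toRat G * paraStar (toRat G)) f c =
      ∫⁻ θ : UnitAddCircle, ENNReal.ofReal (∑ l, ‖onCircle (∑ i, f i * (G i l : RatFunc ℂ)) θ -
        (∑ i, laurentRowC c i * circ (G i l)) θ‖ ^ 2) ∂AddCircle.haarAddCircle := by
  refine lintegral_congr_ae ?_
  filter_upwards [ae_all_iff.2 fun i => ae_regular (f i)] with θ hθ
  congr 1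
  have hG : ∀ i l, (G i l : RatFunc ℂ) ∈ regularOn {(AddCircle.toCircle θ : ℂ)} :=
    fun i l => not_pole_toCircle (G i l).2 θ
  have h1 : ∀ j k, onCircle ((toRat G * paraStar (toRat G)) j k) θ =
      ∑ l, circ (G j l) θ * (starRingEnd ℂ) (circ (G k l) θ) := by
    intro j k
    have h2 : (toRat G * paraStar (toRat G)) j k =
        ((∑ l, G j l * paraConjReg (G k l) : circleRegular) : RatFunc ℂ) := by
      simp only [Matrix.mul_apply, paraStar_apply, AddSubmonoidClass.coe_finsetSum]
      rfl
    rw [h2, ← circ_apply, map_sum, ContinuousMap.sum_apply]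
    refine Finset.sum_congr rfl fun l _ => ?_
    rw [map_mul, circ_paraConj]
    rfl
  have h3 : ∀ l, onCircle (∑ i, f i * (G i l : RatFunc ℂ)) θ =
      ∑ i, onCircle (f i) θ * circ (G i l) θ := by
    intro l
    rw [onCircle, evalAt_sum _ _ fun i _ => mul_mem (hθ i) (hG i l)]
    exact Finset.sum_congr rfl fun i _ => evalAt_mul (hθ i _ rfl) (hG i l _ rfl)
  simp only [h1, h3, ContinuousMap.sum_apply, ContinuousMap.mul_apply, laurentRowC_apply]
  set a : κ' → ℂ := fun i => onCircle (f i) θ - laurentRow c θ i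
  have h4 : ∀ l, ∑ i, onCircle (f i) θ * circ (G i l) θ - ∑ i, laurentRow c θ i * circ (G i l) θ =
      ∑ i, a i * circ (G i l) θ := by
    intro l; simp only [a, sub_mul, Finset.sum_sub_distrib]
  simp only [h4]
  have h5 : ∑ j, ∑ k, a j * (∑ l, circ (G j l) θ * (starRingEnd ℂ) (circ (G k l) θ)) *
      (starRingEnd ℂ) (a k) =
      ((∑ l, ‖∑ i, a i * circ (G i l) θ‖ ^ 2 : ℝ) : ℂ) := by
    push_cast
    simp only [← Complex.mul_conj', map_sum, map_mul, Finset.sum_mul_sum]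
    symm
    rw [Finset.sum_comm]
    refine Finset.sum_congr rfl fun j _ => ?_
    rw [Finset.sum_comm]
    refine Finset.sum_congr rfl fun k _ => ?_
    rw [Finset.mul_sum, Finset.sum_mul]
    exact Finset.sum_congr rfl fun l _ => by ring
  have h6 := congrArg Complex.re h5
  rw [Complex.ofReal_re] at h6
  exact h6

/-- The two smallness conditions in `IsFilterOutput` thus measure the same error, one of them
squared. Only `f G`, not `f`, has to be free of circle poles. -/
theorem spectralDist_eq_norm (he : IsNormalizedWhiteNoise e) (G : Matrix κ' κ circleRegular)
    (u : RandomSeq P κ') (hu : ∀ t i, u t i = synth he t fun j => circ (G i j))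
    (f : κ' → RatFunc ℂ) (S : κ → circleRegular)
    (hS : ∀ l, ∑ i, f i * (G i l : RatFunc ℂ) = S l) (c : ℤ × κ' →₀ ℂ) (t : ℤ) :
    spectralDist (toRat G * paraStar (toRat G)) f c =
      ENNReal.ofReal (‖synth he t (fun l => circ (S l)) - laurentApply c u t‖ ^ 2) := by
  rw [spectralDist_eq, laurentApply_eq_synth he G u hu, ← map_sub, ← lintegral_sum_norm_sq]
  simp only [hS]
  rfl

/-- With `d` a common denominator of `f` and `q d` close to `1`, the coefficients `q d f i` have no
circle poles, can be expanded in Fourier series, and produce `q d S`, close to `S`. -/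
theorem synth_mem_closure_laurentApply (he : IsNormalizedWhiteNoise e)
    (G : Matrix κ' κ circleRegular)
    (u : RandomSeq P κ') (hu : ∀ t i, u t i = synth he t fun j => circ (G i j))
    (f : κ' → RatFunc ℂ) (S : κ → circleRegular)
    (hS : ∀ l, ∑ i, f i * (G i l : RatFunc ℂ) = S l) (t : ℤ) (ε : ℝ) (hε : 0 < ε) :
    ∃ c : ℤ × κ' →₀ ℂ, ‖synth he t (fun l => circ (S l)) - laurentApply c u t‖ < ε := by
  set A : (ℤ × κ' →₀ ℂ) →ₗ[ℂ] Lp ℂ 2 P :=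
    Finsupp.linearCombination ℂ fun q => u (t - q.1) q.2
  have hA : ∀ c, A c = laurentApply c u t := fun c => rfl
  have hmem : synth he t (fun l => circ (S l)) ∈ (LinearMap.range A).topologicalClosure := by
    refine synth_mem_of_approx he t (Submodule.isClosed_topologicalClosure _) Set.univ G S ?_ ?_
    · intro k _ i
      refine Submodule.le_topologicalClosure _ ⟨Finsupp.single (k, i) 1, ?_⟩
      simp only [A, Finsupp.linearCombination_single, one_smul]
      rw [hu, synth_sub]
    · intro δ hδ
      set d : Polynomial ℂ := ∏ i, (f i).denom
      have hd : d ≠ 0 := Finset.prod_ne_zero_iff.2 fun i _ => RatFunc.denom_ne_zero _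
      obtain ⟨q, hq, -⟩ := exists_mul_approx_one d hd δ hδ
      set a : κ' → Polynomial ℂ := fun i => (f i).num * ∏ k ∈ Finset.univ.erase i, (f k).denom
      have ha : ∀ i, algebraMap _ (RatFunc ℂ) (a i) = algebraMap _ (RatFunc ℂ) d * f i := by
        intro i
        simp only [a, d]
        rw [← Finset.mul_prod_erase Finset.univ _ (Finset.mem_univ i), map_mul, map_mul]
        have h1 : algebraMap _ (RatFunc ℂ) (f i).num =
            algebraMap _ (RatFunc ℂ) (f i).denom * f i := by
          rw [mul_comm, ← div_eq_iff, RatFunc.num_div_denom]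
          exact RatFunc.algebraMap_ne_zero (RatFunc.denom_ne_zero _)
        rw [h1]; ring
      refine ⟨_, fun i => q * ⟨_, polynomial_mem_regularOn _ (a i)⟩, hq, by simp, fun l => ?_⟩
      refine Subtype.ext ?_
      simp only [AddSubmonoidClass.coe_finsetSum, Subring.coe_mul, ha, ← hS, Finset.mul_sum]
      exact Finset.sum_congr rfl fun i _ => by ring
  rw [← SetLike.mem_coe, Submodule.topologicalClosure_coe, Metric.mem_closure_iff] at hmem
  obtain ⟨_, ⟨c, rfl⟩, hc⟩ := hmem ε hε
  exact ⟨c, by rwa [dist_eq_norm, hA] at hc⟩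

variable {ι : Type*}

/-- `T(z) u(t)` exists and is the process `S(z) e(t)` when `u(t) = G(z) e(t)` and `T G = S`. -/
theorem isFilterOutput_of_mul_eq (he : IsNormalizedWhiteNoise e) (G : Matrix κ' κ circleRegular)
    (u : RandomSeq P κ') (hu : ∀ t i, u t i = synth he t fun j => circ (G i j))
    (T : Matrix ι κ' (RatFunc ℂ)) (S : Matrix ι κ circleRegular) (hS : T * toRat G = toRat S) :
    IsFilterOutput (toRat G * paraStar (toRat G)) T u
      (fun t i => synth he t fun j => circ (S i j)) := by
  intro t i ε hε
  have hS' : ∀ l, ∑ k, T i k * (G k l : RatFunc ℂ) = S i l := fun l => congrFun₂ hS i l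
  -- An error below both `ε` and `1` also has its square below `ε`, as the spectral distance
  -- requires.
  obtain ⟨c, hc⟩ := synth_mem_closure_laurentApply he G u hu (T i) (S i) hS' t (min ε 1)
    (by positivity)
  refine ⟨c, ?_, hc.trans_le (min_le_left _ _)⟩
  rw [spectralDist_eq_norm he G u hu (T i) (S i) hS' c t]
  refine (ENNReal.ofReal_lt_ofReal_iff hε).2 ?_
  have h1 := hc.trans_le (min_le_left _ _)
  have h2 := hc.trans_le (min_le_right _ _)
  nlinarith [norm_nonneg (synth he t (fun l => circ (S i l)) - laurentApply c u t)]

theorem IsFilterOutput.eq_synth (he : IsNormalizedWhiteNoise e) (G : Matrix κ' κ circleRegular)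
    (u : RandomSeq P κ') (hu : ∀ t i, u t i = synth he t fun j => circ (G i j))
    {T : Matrix ι κ' (RatFunc ℂ)} (S : Matrix ι κ circleRegular) (hS : T * toRat G = toRat S)
    {x : RandomSeq P ι} (hx : IsFilterOutput (toRat G * paraStar (toRat G)) T u x)
    (t : ℤ) (i : ι) : x t i = synth he t fun j => circ (S i j) := by
  have hS' : ∀ l, ∑ k, T i k * (G k l : RatFunc ℂ) = S i l := fun l => congrFun₂ hS i l
  rw [← sub_eq_zero, ← norm_eq_zero]
  refine le_antisymm (le_of_forall_pos_le_add fun δ hδ => ?_) (norm_nonneg _)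
  obtain ⟨c, h1, h2⟩ := hx t i (min (δ / 2) ((δ / 2) ^ 2)) (by positivity)
  rw [spectralDist_eq_norm he G u hu (T i) (S i) hS' c t,
    ENNReal.ofReal_lt_ofReal_iff (by positivity)] at h1
  have h3 := lt_of_pow_lt_pow_left₀ 2 (by positivity) (h1.trans_le (min_le_right _ _))
  have h4 := h2.trans_le (min_le_left _ _)
  have h5 := norm_sub_le_norm_sub_add_norm_sub (x t i) (laurentApply c u t)
    (synth he t fun j => circ (S i j))
  rw [norm_sub_rev] at h3
  linarith

/-- Here `T G` may a priori have circle poles, so the comparison is made with extended integrals: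
`‖a - s‖² ≤ 2 ‖a - b‖² + 2 ‖s - b‖²`, with `b` the Laurent approximation, shows that `T G - S`
vanishes almost everywhere, hence identically. -/
theorem IsFilterOutput.mul_eq (he : IsNormalizedWhiteNoise e) (G : Matrix κ' κ circleRegular)
    (u : RandomSeq P κ') (hu : ∀ t i, u t i = synth he t fun j => circ (G i j))
    {T : Matrix ι κ' (RatFunc ℂ)} (S : Matrix ι κ circleRegular)
    {x : RandomSeq P ι} (hx : IsFilterOutput (toRat G * paraStar (toRat G)) T u x)
    (t : ℤ) (hxS : ∀ i, x t i = synth he t fun j => circ (S i j)) : T * toRat G = toRat S := by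
  ext i l₀ : 2
  set g : κ → RatFunc ℂ := fun l => ∑ k, T i k * (G k l : RatFunc ℂ)
  set F : UnitAddCircle → ENNReal := fun θ =>
    ENNReal.ofReal (∑ l, ‖onCircle (g l) θ - circ (S i l) θ‖ ^ 2)
  have hmeas : Measurable F := by
    refine ENNReal.measurable_ofReal.comp (Finset.measurable_sum _ fun l _ => ?_)
    exact (((measurable_onCircle _).sub (circ (S i l)).continuous.measurable).norm).pow_const 2
  have hF : ∫⁻ θ, F θ ∂AddCircle.haarAddCircle = 0 := by
    refine le_antisymm (ENNReal.le_of_forall_pos_le_add fun ε hε _ => ?_) bot_le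
    have hε' : (0 : ℝ) < ε := hε
    obtain ⟨c, h1, h2⟩ := hx t i (min (ε / 4) 1) (by positivity)
    rw [hxS, laurentApply_eq_synth he G u hu, ← map_sub] at h2
    set b : κ → C(UnitAddCircle, ℂ) := fun j => ∑ i, laurentRowC c i * circ (G i j)
    have h3 : ∫⁻ θ : UnitAddCircle, ENNReal.ofReal (∑ l, ‖(circ (S i l) - b l) θ‖ ^ 2)
        ∂AddCircle.haarAddCircle < ENNReal.ofReal (ε / 4) := by
      refine (lintegral_sum_norm_sq he t fun l => circ (S i l) - b l).trans_lt ?_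
      refine (ENNReal.ofReal_lt_ofReal_iff (by positivity)).2 ?_
      have h4 := h2.trans_le (min_le_left _ _)
      have h5 := h2.trans_le (min_le_right _ _)
      change ‖synth he t (fun l => circ (S i l) - b l)‖ < _ at h4
      change ‖synth he t (fun l => circ (S i l) - b l)‖ < _ at h5
      nlinarith [norm_nonneg (synth he t (fun l => circ (S i l) - b l))]
    rw [spectralDist_eq] at h1
    have h1' := h1.trans_le (ENNReal.ofReal_le_ofReal (min_le_left _ _))
    have hcm : Measurable fun θ : UnitAddCircle =>
        ENNReal.ofReal (∑ l, ‖(circ (S i l) - b l) θ‖ ^ 2) := by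
      refine ENNReal.measurable_ofReal.comp (Continuous.measurable ?_)
      fun_prop
    calc ∫⁻ θ, F θ ∂AddCircle.haarAddCircle
        ≤ ∫⁻ θ, (2 * ENNReal.ofReal (∑ l, ‖onCircle (g l) θ - b l θ‖ ^ 2) +
            2 * ENNReal.ofReal (∑ l, ‖(circ (S i l) - b l) θ‖ ^ 2)) ∂AddCircle.haarAddCircle := by
          refine lintegral_mono fun θ => ?_
          simp only [F]
          rw [← ENNReal.ofReal_ofNat 2, ← ENNReal.ofReal_mul zero_le_two,
            ← ENNReal.ofReal_mul zero_le_two, ← ENNReal.ofReal_add (by positivity) (by positivity)]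
          refine ENNReal.ofReal_le_ofReal ?_
          rw [Finset.mul_sum, Finset.mul_sum, ← Finset.sum_add_distrib]
          refine Finset.sum_le_sum fun l _ => ?_
          have h6 := norm_sub_le_norm_sub_add_norm_sub (onCircle (g l) θ) (b l θ) (circ (S i l) θ)
          rw [norm_sub_rev (b l θ)] at h6
          rw [ContinuousMap.sub_apply]
          have h7 := pow_le_pow_left₀ (norm_nonneg _) h6 2
          nlinarith [sq_nonneg (‖onCircle (g l) θ - b l θ‖ - ‖circ (S i l) θ - b l θ‖)]
      _ ≤ 2 * ENNReal.ofReal (ε / 4) + 2 * ENNReal.ofReal (ε / 4) := by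
          rw [lintegral_add_right _ (hcm.const_mul 2), lintegral_const_mul' _ _ (by simp),
            lintegral_const_mul' _ _ (by simp)]
          gcongr
      _ = 0 + ε := by
          rw [← ENNReal.ofReal_ofNat 2, ← ENNReal.ofReal_mul zero_le_two,
            ← ENNReal.ofReal_add (by positivity) (by positivity), zero_add,
            show (2 * ((ε : ℝ) / 4) + 2 * (ε / 4)) = ε by ring, ENNReal.ofReal_coe_nnreal]
  rw [lintegral_eq_zero_iff hmeas] at hF
  have hz : g l₀ - (S i l₀ : RatFunc ℂ) = 0 := by
    refine eq_zero_of_onCircle_ae_eq_zero ?_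
    filter_upwards [hF, ae_regular (g l₀)] with θ h1 h2
    rw [onCircle, evalAt_sub (h2 _ rfl) (not_pole_toCircle (S i l₀).2 θ _ rfl)]
    have h3 := ENNReal.ofReal_eq_zero.1 h1
    have h4 := Finset.single_le_sum (f := fun l => ‖onCircle (g l) θ - circ (S i l) θ‖ ^ 2)
      (fun l _ => by positivity) (Finset.mem_univ l₀)
    have h5 : ‖onCircle (g l₀) θ - circ (S i l₀) θ‖ ^ 2 = 0 :=
      le_antisymm (h4.trans h3) (by positivity)
    exact norm_eq_zero.1 (pow_eq_zero_iff two_ne_zero |>.1 h5)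
  exact sub_eq_zero.1 hz

end Filters

/-! ### Left inverses of minimum-phase matrices -/

section LeftInverse

variable {κ ρ : Type*} [Fintype κ] [DecidableEq κ] [Fintype ρ] [DecidableEq ρ]

theorem exists_left_inverse_of_mulVec_ne_zero (A : Matrix κ ρ ℂ)
    (hA : ∀ v : ρ → ℂ, v ≠ 0 → A.mulVec v ≠ 0) : ∃ B : Matrix ρ κ ℂ, B * A = 1 := by
  obtain ⟨g, hg⟩ := LinearMap.exists_leftInverse_of_injective (Matrix.toLin' A)
    (LinearMap.ker_eq_bot'.2 fun v hv => by_contra fun h => hA v h hv)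
  refine ⟨LinearMap.toMatrix' g, ?_⟩
  rw [← LinearMap.toMatrix'_toLin' A, ← LinearMap.toMatrix'_comp, hg, LinearMap.toMatrix'_id]

/-- The polynomials `d` for which `d • 1 = L * G` with `L` stable. -/
def leftInverseIdeal (G : Matrix κ ρ stableRing) : Ideal (Polynomial ℂ) where
  carrier := {d | ∃ L : Matrix ρ κ stableRing,
    L * G = (⟨_, polynomial_mem_regularOn _ d⟩ : stableRing) • (1 : Matrix ρ ρ stableRing)}
  zero_mem' := by
    have h : (⟨_, polynomial_mem_regularOn _ 0⟩ : stableRing) = 0 := Subtype.ext (map_zero _)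
    exact ⟨0, by rw [Matrix.zero_mul, h, zero_smul]⟩
  add_mem' := by
    rintro a b ⟨L, hL⟩ ⟨M, hM⟩
    refine ⟨L + M, ?_⟩
    rw [Matrix.add_mul, hL, hM, ← add_smul]
    congr 1
    exact Subtype.ext (map_add _ _ _).symm
  smul_mem' := by
    rintro c a ⟨L, hL⟩
    refine ⟨(⟨_, polynomial_mem_regularOn _ c⟩ : stableRing) • L, ?_⟩
    rw [Matrix.smul_mul, hL, smul_smul]
    congr 1
    exact Subtype.ext (map_mul _ _ _).symm

/-- Evaluation of stable rational functions at a point of the closed unit disc. -/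
def stableEval (w : ℂ) (hw : ‖w‖ ≤ 1) : stableRing →+* ℂ :=
  (evalHom w).comp (Subring.inclusion (regularOn_mono
    (Set.singleton_subset_iff.2 (mem_closedBall_zero_iff.2 hw))))

/-- A constant left inverse `B` of `G(w)` gives a square stable matrix `B G` whose determinant is
`1` at `w`. The adjugate inverts it up to that determinant, and the numerator of the determinant is
the required `d`. -/
theorem exists_mem_leftInverseIdeal (G : Matrix κ ρ stableRing) (w : ℂ) (hw : ‖w‖ ≤ 1)
    (hG : ∀ v : ρ → ℂ, v ≠ 0 → (G.map (stableEval w hw)).mulVec v ≠ 0) :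
    ∃ d ∈ leftInverseIdeal G, d.eval w ≠ 0 := by
  obtain ⟨B, hB⟩ := exists_left_inverse_of_mulVec_ne_zero _ hG
  set B' : Matrix ρ κ stableRing := B.map fun c => ⟨_, C_mem_regularOn _ c⟩
  have hB' : B'.map (stableEval w hw) = B := by
    ext i j; exact evalAt_C _ _
  set M := B' * G
  have hM : (stableEval w hw).mapMatrix M = 1 := by
    rw [RingHom.mapMatrix_apply, Matrix.map_mul, hB', hB]
  have hdet : stableEval w hw M.det = 1 := by
    rw [RingHom.map_det, hM, Matrix.det_one]
  set δ : RatFunc ℂ := (M.det : RatFunc ℂ)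
  have hδ : evalAt w δ = 1 := hdet
  refine ⟨δ.num, ⟨(⟨_, polynomial_mem_regularOn _ δ.denom⟩ : stableRing) • (M.adjugate * B'), ?_⟩,
    ?_⟩
  · rw [Matrix.smul_mul, Matrix.mul_assoc, Matrix.adjugate_mul, smul_smul]
    congr 1
    refine Subtype.ext ?_
    change algebraMap _ (RatFunc ℂ) δ.denom * δ = algebraMap _ (RatFunc ℂ) δ.num
    rw [mul_comm, ← eq_div_iff, RatFunc.num_div_denom]
    exact RatFunc.algebraMap_ne_zero (RatFunc.denom_ne_zero _)
  · intro h
    rw [evalAt_eq_div, h, zero_div] at hδ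
    exact zero_ne_one hδ

/-- Local to global: the generator of the ideal divides, for each point of the open disc, a member
not vanishing there, so it has no zero in the open disc. -/
theorem IsMinimumPhase.exists_stable_mul_eq_smul_one {G : Matrix κ ρ (RatFunc ℂ)}
    (hG : IsMinimumPhase G) : ∃ (d : Polynomial ℂ) (L : Matrix ρ κ (RatFunc ℂ)),
      d ≠ 0 ∧ (∀ w, ‖w‖ < 1 → d.eval w ≠ 0) ∧ IsStable L ∧
      L * G = algebraMap _ (RatFunc ℂ) d • (1 : Matrix ρ ρ (RatFunc ℂ)) := by
  set G' : Matrix κ ρ stableRing := fun i j => ⟨G i j, isStable_iff.1 hG.1 i j⟩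
  have hmem : ∀ w, ‖w‖ < 1 → ∃ d ∈ leftInverseIdeal G', d.eval w ≠ 0 :=
    fun w hw => exists_mem_leftInverseIdeal G' w hw.le fun v hv => hG.2 w hw v hv
  set d := Submodule.IsPrincipal.generator (leftInverseIdeal G')
  have hd : ∀ w, ‖w‖ < 1 → d.eval w ≠ 0 := by
    intro w hw h
    obtain ⟨d', h1, h2⟩ := hmem w hw
    exact h2 (Polynomial.eval_eq_zero_of_dvd_of_eval_eq_zero
      ((Submodule.IsPrincipal.mem_iff_generator_dvd _).1 h1) h)
  obtain ⟨L, hL⟩ : d ∈ leftInverseIdeal G' := Submodule.IsPrincipal.generator_mem _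
  refine ⟨d, L.map stableRing.subtype, ?_, hd, isStable_iff.2 fun i j => (L i j).2, ?_⟩
  · rintro h
    exact hd 0 (by simp) (by rw [h, Polynomial.eval_zero])
  · have h1 := congrArg (fun M => M.map stableRing.subtype) hL
    simp only [Matrix.map_mul] at h1
    refine h1.trans ?_
    ext i j : 2
    by_cases h : i = j <;> simp [h]

theorem IsMinimumPhase.exists_left_inverse {G : Matrix κ ρ (RatFunc ℂ)}
    (hG : IsMinimumPhase G) : ∃ L : Matrix ρ κ (RatFunc ℂ), L * G = 1 := by
  obtain ⟨d, L, hd, -, -, hL⟩ := hG.exists_stable_mul_eq_smul_one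
  refine ⟨(algebraMap _ (RatFunc ℂ) d)⁻¹ • L, ?_⟩
  rw [Matrix.smul_mul, hL, smul_smul, inv_mul_cancel₀, one_smul]
  exact RatFunc.algebraMap_ne_zero hd

end LeftInverse

/-! ### The past and the predictor -/

/-- The para-conjugate transpose of a matrix without poles on the circle. -/
def paraStarReg {ι κ : Type*} (M : Matrix ι κ circleRegular) : Matrix κ ι circleRegular :=
  (M.map paraConjReg).transpose

theorem toRat_mul {ι κ ν : Type*} [Fintype κ] (M : Matrix ι κ circleRegular)
    (N : Matrix κ ν circleRegular) : toRat (M * N) = toRat M * toRat N := Matrix.map_mul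

theorem toRat_injective {ι κ : Type*} :
    Function.Injective (toRat : Matrix ι κ circleRegular → Matrix ι κ (RatFunc ℂ)) :=
  Matrix.map_injective Subtype.val_injective

theorem toRat_one {ι : Type*} [DecidableEq ι] : toRat (1 : Matrix ι ι circleRegular) = 1 :=
  Matrix.map_one _ (map_zero _) (map_one _)

theorem paraStar_toRat {ι κ : Type*} (M : Matrix ι κ circleRegular) :
    paraStar (toRat M) = toRat (paraStarReg M) := by
  ext i j : 2
  exact paraStar_apply _ _ _

theorem paraStarReg_mul {ι κ ν : Type*} [Fintype κ] (M : Matrix ι κ circleRegular)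
    (N : Matrix κ ν circleRegular) : paraStarReg (M * N) = paraStarReg N * paraStarReg M := by
  apply toRat_injective
  rw [toRat_mul, ← paraStar_toRat, ← paraStar_toRat, ← paraStar_toRat, toRat_mul, paraStar_mul]

/-- `z`, as a function without poles on the circle. -/
def zReg : circleRegular := ⟨zVar, zVar_mem_regularOn (by simp)⟩

/-- `z⁻¹`, as a function without poles on the circle. -/
def delayReg : circleRegular := ⟨RatFunc.X, X_mem_regularOn _⟩

theorem delayReg_mul_zReg : delayReg * zReg = 1 :=
  Subtype.ext (mul_inv_cancel₀ X_ne_zero')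

theorem paraConjReg_delayReg : paraConjReg delayReg = zReg := by
  refine Subtype.ext ?_
  rw [coe_paraConjReg]
  refine (RatFunc.liftRingHom_X _ _).trans ?_
  rw [conjAtZ_apply, Polynomial.map_X, Polynomial.aeval_X]
  rfl

theorem circ_delayReg_pow (n : ℕ) : circ (delayReg ^ n) = fourier (n : ℤ) := circ_X_pow n

theorem inner_toL2_circ (a b : circleRegular) :
    inner ℂ (toL2 (circ a)) (toL2 (circ b)) = laurentCoeff (b * paraConjReg a : circleRegular) 0 := by
  rw [ContinuousMap.inner_toLp, laurentCoeff_eq_integral]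
  refine integral_congr_ae (Filter.Eventually.of_forall fun θ => ?_)
  simp only [neg_zero, fourier_zero, one_mul]
  rw [← circ_apply, map_mul, circ_paraConj]
  rfl

theorem laurentCoeff_add (f g : circleRegular) (k : ℤ) :
    laurentCoeff (f + g : circleRegular) k = laurentCoeff f k + laurentCoeff g k := by
  simp only [laurentCoeff_eq, map_add]; rfl

theorem laurentCoeff_sub (f g : circleRegular) (k : ℤ) :
    laurentCoeff (f - g : circleRegular) k = laurentCoeff f k - laurentCoeff g k := by
  simp only [laurentCoeff_eq, map_sub]; rfl

theorem laurentCoeff_sum {ι : Type*} (s : Finset ι) (f : ι → circleRegular) (k : ℤ) :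
    laurentCoeff (∑ i ∈ s, f i : circleRegular) k = ∑ i ∈ s, laurentCoeff (f i) k := by
  classical
  induction s using Finset.induction_on with
  | empty =>
    rw [Finset.sum_empty, Finset.sum_empty, laurentCoeff_eq, map_zero, map_zero, map_zero]; rfl
  | insert a s ha ih => rw [Finset.sum_insert ha, Finset.sum_insert ha, laurentCoeff_add, ih]

/-- Parseval, for Fourier coefficients with disjoint supports. -/
theorem inner_toL2_circ_eq_zero {a b : circleRegular} (ha : (a : RatFunc ℂ) ∈ stableRing)
    (hb : ∀ k : ℤ, 0 ≤ k → laurentCoeff b k = 0) :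
    inner ℂ (toL2 (circ a)) (toL2 (circ b)) = 0 := by
  rw [← (fourierBasis (T := 1)).repr.inner_map_map, lp.inner_eq_tsum]
  refine (tsum_congr fun k => ?_).trans tsum_zero
  rw [← laurentCoeff_eq, ← laurentCoeff_eq]
  rcases lt_or_ge k 0 with hk | hk
  · rw [laurentCoeff_of_stable_of_neg ha hk, inner_zero_left]
  · rw [hb k hk, inner_zero_right]

section Predictor

variable {Ω : Type*} [MeasurableSpace Ω] {P : Measure Ω} {κ π ρ ι : Type*} {e : RandomSeq P κ}
  [Fintype κ] [Fintype π] [DecidableEq π] [Fintype ρ] [DecidableEq ρ]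

/-- If `u(t) = G(z) Q(z) e(t)` with `G` minimum-phase, then `S(z) Q(z) e(t)` with `S` stable is in
the past of `u`. -/
theorem synth_mem_past (he : IsNormalizedWhiteNoise e)
    (G : Matrix π ρ circleRegular) (hG : IsMinimumPhase (toRat G)) (Q : Matrix ρ κ circleRegular)
    (u : RandomSeq P π) (hu : ∀ t i, u t i = synth he t fun j => circ ((G * Q) i j))
    (S : Matrix ι ρ circleRegular) (hS : IsStable (toRat S)) (t : ℤ) (i : ι) :
    (synth he t fun j => circ ((S * Q) i j)) ∈ past u t := by
  obtain ⟨d, L, hd0, hd, hLs, hL⟩ := hG.exists_stable_mul_eq_smul_one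
  obtain ⟨L, rfl⟩ := exists_toRat fun i j => stableRing_le (isStable_iff.1 hLs i j)
  set dr : circleRegular := ⟨_, polynomial_mem_regularOn _ d⟩
  have hL' : L * G = dr • (1 : Matrix ρ ρ circleRegular) := by
    apply toRat_injective
    rw [toRat_mul, hL]
    ext i j : 2
    by_cases h : i = j <;> simp [h, dr]
  refine synth_mem_of_approx he t (Submodule.isClosed_topologicalClosure _) {k | 0 ≤ k} (G * Q)
    (fun j => (S * Q) i j) ?_ ?_
  · intro k hk j
    rw [← synth_sub, ← hu]
    exact Submodule.le_topologicalClosure _ (Submodule.subset_span ⟨t - k, by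
      simp only [Set.mem_ofPred_eq] at hk; omega, j, rfl⟩)
  · intro ε hε
    obtain ⟨q, hq, hqs⟩ := exists_mul_approx_one d hd0 ε hε
    -- The coefficients `q S L` are causal, and `q S L G Q = q d S Q` because `L G = d`.
    refine ⟨q * dr, fun j => q * (S * L) i j, hq, fun j k hk => ?_, fun j => ?_⟩
    · refine laurentCoeff_of_stable_of_neg (mul_mem (hqs hd) ?_) (not_le.1 hk)
      rw [Matrix.mul_apply, AddSubmonoidClass.coe_finsetSum]
      exact sum_mem fun a _ => mul_mem (isStable_iff.1 hS i a) (isStable_iff.1 hLs a j)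
    · have h1 : S * L * (G * Q) = dr • (S * Q) := by
        rw [Matrix.mul_assoc, ← Matrix.mul_assoc L, hL', Matrix.smul_mul, Matrix.one_mul,
          Matrix.mul_smul]
      have h2 := congrFun₂ h1 i j
      rw [Matrix.mul_apply, Matrix.smul_apply, smul_eq_mul] at h2
      simp only [mul_assoc, ← Finset.mul_sum, h2]

/-- Since `Q Q* = I`, the error times `(G Q)*` is `w D G*` with `D = z V Q* - S`. A lag of `n + 1`
contributes `z ^ (n + 1)`, one power of which cancels `w`; what is left pairs `D`, orthogonal to
`H²`, with the stable `w ^ n G`. -/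
theorem inner_synth_past_eq_zero {σ : Type*} (he : IsNormalizedWhiteNoise e)
    (G : Matrix σ ρ circleRegular) (hG : IsStable (toRat G)) (Q : Matrix ρ κ circleRegular)
    (hQ : Q * paraStarReg Q = 1) (V : Matrix ι κ circleRegular) (S : Matrix ι ρ circleRegular)
    (hS : ∀ i a, ∀ k : ℤ, 0 ≤ k →
      laurentCoeff ((zReg • (V * paraStarReg Q) - S) i a : circleRegular) k = 0)
    (t : ℤ) (n : ℕ) (i : ι) (j : σ) :
    inner ℂ (synth he t fun l => fourier ((n + 1 : ℕ) : ℤ) * circ ((G * Q) j l))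
      (synth he t fun l => circ ((V - delayReg • (S * Q)) i l)) = 0 := by
  rw [inner_synth]
  simp only [← circ_delayReg_pow, ← map_mul, inner_toL2_circ]
  rw [← laurentCoeff_sum]
  set D := zReg • (V * paraStarReg Q) - S
  have h1 : (V - delayReg • (S * Q)) * paraStarReg (G * Q) = delayReg • (D * paraStarReg G) := by
    have h2 : delayReg • D = V * paraStarReg Q - delayReg • S := by
      simp only [D]
      rw [smul_sub, smul_smul, delayReg_mul_zReg, one_smul]
    rw [← Matrix.smul_mul delayReg D, h2, paraStarReg_mul, ← Matrix.mul_assoc, Matrix.sub_mul,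
      Matrix.smul_mul, Matrix.mul_assoc S, hQ, Matrix.mul_one]
  have h3 : ∑ l, (V - delayReg • (S * Q)) i l * paraConjReg (delayReg ^ (n + 1) * (G * Q) j l) =
      ∑ a, D i a * paraConjReg (delayReg ^ n * G j a) := by
    have h4 := congrFun₂ h1 i j
    rw [Matrix.mul_apply, Matrix.smul_apply, smul_eq_mul, Matrix.mul_apply] at h4
    simp only [map_mul, map_pow, paraConjReg_delayReg]
    have h5 : ∀ a b c : circleRegular, a * (b * c) = b * (a * c) := fun a b c => by ring
    simp only [h5 _ (zReg ^ _), ← Finset.mul_sum]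
    refine (congrArg (zReg ^ (n + 1) * ·) h4).trans ?_
    rw [pow_succ]
    simp only [← mul_assoc]
    rw [mul_assoc (zReg ^ n), mul_comm zReg, delayReg_mul_zReg, mul_one]
    rfl
  rw [h3, laurentCoeff_sum]
  refine Finset.sum_eq_zero fun a _ => ?_
  rw [← inner_toL2_circ]
  exact inner_toL2_circ_eq_zero (mul_mem (pow_mem (X_mem_regularOn _) n)
    (isStable_iff.1 hG j a)) (hS i a)

/-- The one-step predictor from the process `G(z) Q(z) e(t)` of the process `V(z) e(t)`. -/
theorem oneStepPredictor_eq_synth (he : IsNormalizedWhiteNoise e)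
    (G : Matrix π ρ circleRegular) (hG : IsMinimumPhase (toRat G)) (Q : Matrix ρ κ circleRegular)
    (hQ : Q * paraStarReg Q = 1) (V : Matrix ι κ circleRegular) (S : Matrix ι ρ circleRegular)
    (hSs : IsStable (toRat S))
    (hS : ∀ i a, ∀ k : ℤ, 0 ≤ k →
      laurentCoeff ((zReg • (V * paraStarReg Q) - S) i a : circleRegular) k = 0)
    (u : RandomSeq P π) (hu : ∀ t i, u t i = synth he t fun j => circ ((G * Q) i j))
    (v : RandomSeq P ι) (hv : ∀ t i, v t i = synth he t fun j => circ (V i j)) (t : ℤ) (i : ι) :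
    oneStepPredictor v u t i = synth he (t - 1) fun j => circ ((S * Q) i j) := by
  have : CompleteSpace (past u (t - 1)) :=
    (Submodule.isClosed_topologicalClosure _).completeSpace_coe
  refine Submodule.eq_starProjection_of_mem_orthogonal (synth_mem_past he G hG Q u hu S hSs _ i) ?_
  rw [past, Submodule.orthogonal_closure, Submodule.mem_orthogonal]
  have h1 : v t i - (synth he (t - 1) fun j => circ ((S * Q) i j)) =
      synth he t fun l => circ ((V - delayReg • (S * Q)) i l) := by
    rw [hv, synth_sub, ← map_sub]
    congr 1
    funext l
    have h2 := circ_delayReg_pow 1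
    rw [pow_one, Nat.cast_one] at h2
    simp only [Pi.sub_apply, Matrix.sub_apply, Matrix.smul_apply, smul_eq_mul, map_sub, map_mul, h2]
  rw [h1]
  intro x hx
  induction hx using Submodule.span_induction with
  | mem x hx =>
    obtain ⟨s, hs, j, rfl⟩ := hx
    obtain ⟨n, hn⟩ := Int.eq_ofNat_of_zero_le (show 0 ≤ t - 1 - s by omega)
    have h2 : s = t - ((n + 1 : ℕ) : ℤ) := by push_cast; omega
    rw [hu, h2, synth_sub]
    exact inner_synth_past_eq_zero he G hG.1 Q hQ V S hS t n i j
  | zero => exact inner_zero_left _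
  | add x y _ _ hx hy => rw [inner_add_left, hx, hy, add_zero]
  | smul c x _ hx => rw [inner_smul_left, hx, mul_zero]

end Predictor

/-! ### Hardy projections of matrices, and auxiliary algebra. -/

theorem exists_isHardyProjection {ι κ : Type*} (D : Matrix ι κ circleRegular) :
    ∃ S : Matrix ι κ circleRegular, IsStable (toRat S) ∧
      (∀ i j, ∀ k : ℤ, 0 ≤ k → laurentCoeff ((D - S) i j : circleRegular) k = 0) ∧
      IsHardyProjection (toRat D) (toRat S) := by
  choose S hS hD using fun i j => exists_splitting (D i j)
  exact ⟨S, isStable_iff.2 hS, hD, noCirclePoles_iff.2 fun i j => (D i j).2, isStable_iff.2 hS, hD⟩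

/-- The difference of two projections is stable and orthogonal to `H²`, so all its Laurent
coefficients vanish. -/
theorem IsHardyProjection.unique {ι κ : Type*} {D S S' : Matrix ι κ (RatFunc ℂ)}
    (h : IsHardyProjection D S) (h' : IsHardyProjection D S') : S' = S := by
  ext i j : 2
  have hD := noCirclePoles_iff.1 h.1 i j
  have hS := isStable_iff.1 h.2.1 i j
  have hS' := isStable_iff.1 h'.2.1 i j
  rw [← sub_eq_zero]
  refine eq_zero_of_laurentCoeff (stableRing_le (sub_mem hS' hS)) fun k => ?_
  rcases lt_or_ge k 0 with hk | hk
  · exact laurentCoeff_of_stable_of_neg (sub_mem hS' hS) hk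
  · have h1 := laurentCoeff_sub ⟨_, sub_mem hD (stableRing_le hS)⟩
      ⟨_, sub_mem hD (stableRing_le hS')⟩ k
    have h2 := h.2.2 i j k hk
    have h3 := h'.2.2 i j k hk
    rw [Matrix.sub_apply] at h2 h3
    rw [h2, h3, sub_zero, AddSubgroupClass.coe_sub, sub_sub_sub_cancel_left] at h1
    exact h1

theorem synth_one {Ω : Type*} [MeasurableSpace Ω] {P : MeasureTheory.Measure Ω} {κ : Type*}
    [Fintype κ] [DecidableEq κ] {e : RandomSeq P κ} (he : IsNormalizedWhiteNoise e) (t : ℤ)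
    (j : κ) : e t j = synth he t fun l => circ ((1 : Matrix κ κ circleRegular) j l) := by
  rw [← synth_single he]
  congr 1
  funext l
  rcases eq_or_ne l j with rfl | h
  · simp
  · rw [Pi.single_eq_of_ne h, Matrix.one_apply_ne h.symm, map_zero]

theorem mul_eq_mul_iff_of_mul_eq_one {R ι κ ρ ν : Type*} [Ring R] [Fintype κ] [Fintype ρ]
    [Fintype ν] [DecidableEq ρ] {F : Matrix ι κ R} {G : Matrix κ ρ R} {Q : Matrix ρ ν R}
    {Q' : Matrix ν ρ R} (hQ : Q * Q' = 1) {S : Matrix ι ρ R} :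
    F * (G * Q) = S * Q ↔ F * G = S := by
  refine ⟨fun h => ?_, fun h => by rw [← Matrix.mul_assoc, h]⟩
  have h1 := congrArg (· * Q') h
  simpa only [Matrix.mul_assoc, hQ, Matrix.mul_one] using h1

theorem rank_eq_of_left_inverse {κ : Type*} [Fintype κ] {r : ℕ} {G : Matrix κ (Fin r) (RatFunc ℂ)}
    {L : Matrix (Fin r) κ (RatFunc ℂ)} [DecidableEq κ] (h : L * G = 1) : G.rank = r := by
  refine le_antisymm ((Matrix.rank_le_card_width G).trans_eq (Fintype.card_fin r)) ?_
  have h1 := Matrix.rank_mul_le_right L G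
  rwa [h, Matrix.rank_one, Fintype.card_fin] at h1

end LowRankWiener

end

/-! ### The feedback representation and the Wiener filters. -/

theorem theorem4p1 {Ω : Type*} [MeasurableSpace Ω] (P : MeasureTheory.Measure Ω)
    [MeasureTheory.IsProbabilityMeasure P] (m p r : ℕ)
    -- the process, its spectral density, and the minimum-phase factor with the innovation
    (y : RandomSeq P (Fin m ⊕ Fin p)) (e : RandomSeq P (Fin m))
    (Φ : Matrix (Fin m ⊕ Fin p) (Fin m ⊕ Fin p) (RatFunc ℂ))
    (W : Matrix (Fin m ⊕ Fin p) (Fin m) (RatFunc ℂ))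
    (hΦ : HasSpectralDensity y Φ)
    (hWΦ : Φ = W * paraStar W) (hW : IsMinimumPhase W) (hW₁ : W.toRows₁.det ≠ 0)
    (he : IsNormalizedWhiteNoise e) (hy : IsFilterOutput 1 W e y)
    -- the outer-inner factorization of the lower block
    (G₂ : Matrix (Fin p) (Fin r) (RatFunc ℂ)) (Q₂ : Matrix (Fin r) (Fin m) (RatFunc ℂ))
    (hG₂ : IsMinimumPhase G₂) (hQ₂ : IsInner Q₂) (hW₂ : W.toRows₂ = G₂ * Q₂)
    -- the two components of the process
    (y₁ : RandomSeq P (Fin m)) (y₂ : RandomSeq P (Fin p))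
    (hy₁ : ∀ t i, y₁ t i = y t (Sum.inl i)) (hy₂ : ∀ t i, y₂ t i = y t (Sum.inr i)) :
    -- `G₂` is a full-rank spectral factor of `Φ₂₂`, and it has left inverses
    (Φ.toBlocks₂₂ = G₂ * paraStar G₂ ∧ G₂.rank = r ∧ W.toRows₂.rank = r ∧
      ∃ L : Matrix (Fin r) (Fin p) (RatFunc ℂ), L * G₂ = 1) ∧
    -- the second equation `y₂(t) = H(z) y₁(t)` of the feedback model
    IsFilterOutput Φ.toBlocks₁₁ (Φ.toBlocks₂₁ * Φ.toBlocks₁₁⁻¹) y₁ y₂ ∧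
    -- the projection `Splus = [z W₁ Q₂*]₊`
    ∃ Splus : Matrix (Fin m) (Fin r) (RatFunc ℂ),
      IsHardyProjection (zVar • (W.toRows₁ * paraStar Q₂)) Splus ∧
      (∀ S', IsHardyProjection (zVar • (W.toRows₁ * paraStar Q₂)) S' → S' = Splus) ∧
      IsStable (W.toRows₁ - zVar⁻¹ • (Splus * Q₂)) ∧
      -- for each left inverse `L`: `y₁(t) = F₊(z) y₂(t-1) + K₊(z) e(t)`, with the first term
      -- equal to the one-step-ahead predictor
      (∀ L : Matrix (Fin r) (Fin p) (RatFunc ℂ), L * G₂ = 1 →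
        ∃ (x v : RandomSeq P (Fin m)),
          IsFilterOutput Φ.toBlocks₂₂ (Splus * L) y₂ x ∧
          IsFilterOutput 1 (W.toRows₁ - zVar⁻¹ • (Splus * Q₂)) e v ∧
          (∀ t i, y₁ t i = x (t - 1) i + v t i) ∧
          (∀ t i, x (t - 1) i = oneStepPredictor y₁ y₂ t i)) ∧
      -- all Wiener filters
      (∀ F : Matrix (Fin m) (Fin p) (RatFunc ℂ),
        IsWienerFilter Φ.toBlocks₂₂ y₁ y₂ F ↔ F * G₂ = Splus) ∧
      -- those of the form `Splus * L`
      (∀ F : Matrix (Fin m) (Fin p) (RatFunc ℂ),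
        (∃ L : Matrix (Fin r) (Fin p) (RatFunc ℂ), L * G₂ = 1 ∧ F = Splus * L) ↔
          (IsWienerFilter Φ.toBlocks₂₂ y₁ y₂ F ∧
            ∃ X : Matrix (Fin r) (Fin p) (RatFunc ℂ), F = Splus * X)) := by
  obtain ⟨W, rfl⟩ := exists_toRat fun i j => stableRing_le (isStable_iff.1 hW.1 i j)
  obtain ⟨G, rfl⟩ := exists_toRat fun i j => stableRing_le (isStable_iff.1 hG₂.1 i j)
  obtain ⟨Q, rfl⟩ := exists_toRat fun i j => stableRing_le (isStable_iff.1 hQ₂.1 i j)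
  obtain ⟨V, hV⟩ : ∃ V : Matrix (Fin m) (Fin m) circleRegular, V = W.toRows₁ := ⟨_, rfl⟩
  have hVr : (toRat W).toRows₁ = toRat V := by rw [hV]; rfl
  have hVs : IsStable (toRat V) := by
    rw [hV]; exact fun i j => hW.1 (Sum.inl i) j
  have hW₂' : W.toRows₂ = G * Q := toRat_injective (by rw [toRat_mul, ← hW₂]; rfl)
  have hQ : Q * paraStarReg Q = 1 := toRat_injective (by
    rw [toRat_mul, ← paraStar_toRat, hQ₂.2, toRat_one])
  rw [hVr] at hW₁ ⊢
  -- the spectral representations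
  have hys : ∀ t i, y t i = synth he t fun j => circ (W i j) := by
    -- The noise is its own synthesis with transfer matrix `1`, so the filter lemmas apply to `W e`.
    refine fun t i => IsFilterOutput.eq_synth he (1 : Matrix (Fin m) (Fin m) circleRegular) e
      (synth_one he) (T := toRat W) W (by rw [toRat_one, Matrix.mul_one]) ?_ t i
    rwa [toRat_one, paraStar_one, Matrix.mul_one]
  have hy₁s : ∀ t i, y₁ t i = synth he t fun j => circ (V i j) := fun t i => by
    rw [hy₁, hys, hV]; rfl
  have hy₂s : ∀ t i, y₂ t i = synth he t fun j => circ ((G * Q) i j) := fun t i => by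
    rw [hy₂, hys, ← hW₂']; rfl
  have h₁₁ : Φ.toBlocks₁₁ = toRat V * paraStar (toRat V) := by rw [hWΦ, hV]; rfl
  have h₂₁ : Φ.toBlocks₂₁ = toRat (G * Q) * paraStar (toRat V) := by
    rw [hWΦ, hV, ← hW₂']; rfl
  have h₂₂ : Φ.toBlocks₂₂ = toRat (G * Q) * paraStar (toRat (G * Q)) := by
    rw [hWΦ, ← hW₂']; rfl
  obtain ⟨S, hSs, hSc, hSp⟩ := exists_isHardyProjection (zReg • (V * paraStarReg Q))
  have hD : zVar • (toRat V * paraStar (toRat Q)) = toRat (zReg • (V * paraStarReg Q)) := by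
    rw [paraStar_toRat, ← toRat_mul]; rfl
  have hK : toRat V - zVar⁻¹ • (toRat S * toRat Q) = toRat (V - delayReg • (S * Q)) := by
    rw [← toRat_mul, zVar, inv_inv]; rfl
  have hpred := oneStepPredictor_eq_synth he G hG₂ Q hQ V S hSs hSc y₂ hy₂s y₁ hy₁s
  have hfilter : ∀ F : Matrix (Fin m) (Fin p) (RatFunc ℂ), F * toRat G = toRat S →
      IsFilterOutput Φ.toBlocks₂₂ F y₂ (fun t i => synth he t fun j => circ ((S * Q) i j)) := by
    intro F hF
    rw [h₂₂]
    refine isFilterOutput_of_mul_eq he (G * Q) y₂ hy₂s F (S * Q) ?_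
    rw [toRat_mul, ← Matrix.mul_assoc, hF, toRat_mul]
  have hwiener : ∀ F : Matrix (Fin m) (Fin p) (RatFunc ℂ),
      IsWienerFilter Φ.toBlocks₂₂ y₁ y₂ F ↔ F * toRat G = toRat S := by
    refine fun F => ⟨?_, fun hF => ⟨_, hfilter F hF, fun t i => (hpred t i).symm⟩⟩
    rintro ⟨x, hx, hxp⟩
    rw [h₂₂] at hx
    -- A single time determines `F G Q`; `0 - 1` matches the predictor of `y₁ 0`.
    have h := IsFilterOutput.mul_eq he (G * Q) y₂ hy₂s (S * Q) hx (0 - 1) fun i => by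
      rw [hxp 0 i, hpred 0 i]
    rw [toRat_mul, toRat_mul] at h
    exact (mul_eq_mul_iff_of_mul_eq_one hQ₂.2).1 h
  obtain ⟨L₀, hL₀⟩ := hG₂.exists_left_inverse
  refine ⟨⟨?_, rank_eq_of_left_inverse hL₀, ?_, L₀, hL₀⟩, ?_, toRat S, ?_, ?_, ?_, ?_, hwiener, ?_⟩
  · rw [h₂₂, toRat_mul, paraStar_mul, Matrix.mul_assoc, ← Matrix.mul_assoc (toRat Q), hQ₂.2,
      Matrix.one_mul]
  · rw [hW₂]
    refine le_antisymm ((Matrix.rank_mul_le_left _ _).trans_eq (rank_eq_of_left_inverse hL₀)) ?_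
    have h := Matrix.rank_mul_le_left (toRat G * toRat Q) (paraStar (toRat Q))
    rwa [Matrix.mul_assoc, hQ₂.2, Matrix.mul_one, rank_eq_of_left_inverse hL₀] at h
  -- With `V = W₁`, `H = W₂ V* (V V*)⁻¹ = W₂ V⁻¹`, so `H V = W₂`.
  · have hH : Φ.toBlocks₂₁ * Φ.toBlocks₁₁⁻¹ * toRat V = toRat (G * Q) := by
      have hu : IsUnit (toRat V).det := hW₁.isUnit
      have hu' : IsUnit (paraStar (toRat V)).det := by
        rw [det_paraStar]; exact ((map_ne_zero _).2 hW₁).isUnit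
      rw [h₁₁, h₂₁, Matrix.mul_inv_rev, Matrix.mul_assoc, Matrix.mul_assoc, Matrix.mul_assoc,
        Matrix.nonsing_inv_mul _ hu, Matrix.mul_one, Matrix.mul_nonsing_inv _ hu', Matrix.mul_one]
    have h := isFilterOutput_of_mul_eq he V y₁ hy₁s _ (G * Q) hH
    rw [← h₁₁] at h
    convert h using 1
    funext t i
    exact hy₂s t i
  · rw [hD]; exact hSp
  · rw [hD]; exact fun S' hS' => hSp.unique hS'
  · rw [hK]
    refine isStable_iff.2 fun i j => sub_mem (isStable_iff.1 hVs i j)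
      (mul_mem (X_mem_regularOn _) ?_)
    rw [Matrix.mul_apply, AddSubmonoidClass.coe_finsetSum]
    exact sum_mem fun a _ => mul_mem (isStable_iff.1 hSs i a) (isStable_iff.1 hQ₂.1 a j)
  · intro L hL
    refine ⟨_, fun t i => synth he t fun j => circ ((V - delayReg • (S * Q)) i j),
      hfilter (toRat S * L) (by rw [Matrix.mul_assoc, hL, Matrix.mul_one]), ?_, ?_,
      fun t i => (hpred t i).symm⟩
    · rw [hK]
      have h := isFilterOutput_of_mul_eq he (1 : Matrix (Fin m) (Fin m) circleRegular) e
        (synth_one he) (toRat (V - delayReg • (S * Q))) (V - delayReg • (S * Q))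
        (by rw [toRat_one, Matrix.mul_one])
      rwa [toRat_one, paraStar_one, Matrix.mul_one] at h
    · intro t i
      rw [hy₁s, synth_sub, ← map_add]
      congr 1
      funext j
      have h := circ_delayReg_pow 1
      rw [pow_one, Nat.cast_one] at h
      simp only [Pi.add_apply, Matrix.sub_apply, Matrix.smul_apply, smul_eq_mul, map_sub, map_mul,
        h, add_sub_cancel]
  · intro F
    constructor
    · rintro ⟨L, hL, rfl⟩
      exact ⟨(hwiener _).2 (by rw [Matrix.mul_assoc, hL, Matrix.mul_one]), L, rfl⟩
    · rintro ⟨hF, X, rfl⟩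
      have hX := (hwiener _).1 hF
      -- The correction turns `X` into a left inverse of `G`, and `S` annihilates it because `S X G
      -- = S`.
      refine ⟨X + (1 - X * toRat G) * L₀, ?_, ?_⟩
      · rw [Matrix.add_mul, Matrix.mul_assoc, hL₀, Matrix.mul_one, add_sub_cancel]
      · rw [Matrix.mul_add, ← Matrix.mul_assoc, Matrix.mul_sub, Matrix.mul_one, ← Matrix.mul_assoc,
          hX, sub_self, Matrix.zero_mul, add_zero]
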